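/- Let $\alpha\in(0,2)$, $\sigma>0$, $\nu\ge 0$. For every $s\in\mathbb R$ let $L_s=(L_s(t))_{t\ge s}$ be a real Lévy process started from $0$ at time $s$ (for instance $L_s(t)=L(t-s)$ for a Lévy process $L$ on $[0,\infty)$) with $\mathbf E\,e^{i\lambda L_s(s+u)}=e^{u\Psi(\lambda)}$, $u\ge 0$, $\lambda\in\mathbb R$, where $\Psi(\lambda)=-\sigma^\alpha|\lambda|^\alpha$. Consider the infinite system with zero initial values at time $s$ \[ a_0^\nu(t;s)=0,\qquad a_1^\nu(t;s)=\int_s^t\bigl(-a_2^\nu(u;s)-\nu a_1^\nu(u;s)\bigr)du+L_s(t), \] \[ a_n^\nu(t;s)=\int_s^t\bigl(a_{n-1}^\nu(u;s)-a_{n+1}^\nu(u;s)-\nu a_n^\nu(u;s)\bigr)du,\quad n\ge 2,\ t\ge s, \] whose solutions are understood in the class of processes with almost surely $\sup_{n\ge 0}\sup_{s\le t\le T}|a_n^\nu(t;s)|<\infty$ for all $T\ge s$. The stationary distribution of $a_n^\nu$ is the pull-back limit: the probability law to which $a_n^\nu(t;s)$ converges in distribution as $s\to-\infty$ ($t$ fixed),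 if there is one. Then: 1. For every $s$ the system has a solution. For any choice of solutions $a^\nu(\cdot\,;s)$, $s\in\mathbb R$, every $n\ge 1$ and every $t\in\mathbb R$, the following holds. 2. If $\nu>0$, the stationary distribution of $a_n^\nu$ exists for every $\alpha\in(0,2)$. If $\nu=0$, it exists if and only if $\alpha\in(\tfrac23,2)$. 3. Whenever the stationary distribution exists, it is (non-degenerate) $\alpha$-stable, $\int_0^\infty |J_n(2r)|^\alpha r^{-\alpha}e^{-\alpha\nu r}\,dr<\infty$, and its characteristic function is, for all $\lambda\in\mathbb R$, \[ \mathbf E\,e^{i\lambda a_n^\nu}=\exp\Bigl(-|\lambda|^\alpha\,\sigma^\alpha n^\alpha\int_0^\infty\frac{|J_n(2r)|^\alpha}{r^\alpha}\,e^{-\alpha\nu r}\,dr\Bigr), \] where $J_n$ is the Bessel function of the first kind; in particular it does not depend on $t$. -/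

import Mathlib

open MeasureTheory ProbabilityTheory Filter Topology Set
open scoped NNReal Nat

/-- The Bessel function of the first kind `J_n` of integer order `n ≥ 0`, by its (everywhere
absolutely convergent) power series. -/
noncomputable def besselJ (n : ℕ) (x : ℝ) : ℝ :=
  ∑' k : ℕ, (-1 : ℝ) ^ k / ((k ! : ℝ) * ((n + k) ! : ℝ)) * (x / 2) ^ (2 * k + n)

section Processes

variable {Ω : Type*} [MeasurableSpace Ω]

/-- A real Lévy process on `[0, ∞)`: it starts at the origin, has independent and stationary
increments, is stochastically continuous, and its paths are (almost surely) right-continuous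
with left limits. -/
structure IsLevyProcess (X : ℝ≥0 → Ω → ℝ) (P : Measure Ω) : Prop where
  measurable : ∀ t, Measurable (X t)
  start : ∀ᵐ ω ∂P, X 0 ω = 0
  indep_increments : HasIndepIncrements X P
  stationary_increments : ∀ s t, IdentDistrib (fun ω => X (s + t) ω - X s ω) (X t) P P
  stoch_continuous : ∀ t, TendstoInMeasure P X (𝓝 t) (X t)
  cadlag : ∀ᵐ ω ∂P, ∀ t : ℝ≥0, ContinuousWithinAt (fun u => X u ω) (Ici t) t ∧
    ∃ l : ℝ, Tendsto (fun u => X u ω) (𝓝[<] t) (𝓝 l)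

/-- `Ψ` is the cumulant of `X`: `E exp(i z X(t)) = exp(t Ψ(z))` for all real `z` and `t ≥ 0`. -/
def HasCumulant (X : ℝ≥0 → Ω → ℝ) (Ψ : ℝ → ℂ) (P : Measure Ω) : Prop :=
  ∀ (t : ℝ≥0) (z : ℝ), charFun (P.map (X t)) z = Complex.exp (((t : ℝ) : ℂ) * Ψ z)

/-- `x n t`, for `t ≥ s`, is a locally bounded (in `ℓ^∞`) path of the space-discrete transport
equation with viscosity `ν` on `[s, ∞)`, with Dirichlet condition at site `0`, initial values
`x₀ n` and forcing path `ℓ` at site `1`. -/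
structure IsTransportPath (ν s : ℝ) (ℓ : ℝ → ℝ) (x₀ : ℕ → ℝ) (x : ℕ → ℝ → ℝ) : Prop where
  bounded : ∀ T, s ≤ T → ∃ C : ℝ, ∀ n, ∀ t ∈ Icc s T, |x n t| ≤ C
  integrable : ∀ n, ∀ t, s ≤ t → IntervalIntegrable (x n) volume s t
  boundary : ∀ t, s ≤ t → x 0 t = 0
  forced : ∀ t, s ≤ t → x 1 t = x₀ 1 + (∫ u in s..t, (-x 2 u - ν * x 1 u)) + ℓ t
  transport : ∀ n, 2 ≤ n → ∀ t, s ≤ t →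
    x n t = x₀ n + ∫ u in s..t, (x (n - 1) u - x (n + 1) u - ν * x n u)

/-- `a n t`, for `t ≥ s`, is a solution of the stochastic space-discrete transport equation
started at time `s` from the initial values `x₀`, with random forcing `ξ`. The (measurable)
values of `a n t` for `t < s` play no role. -/
structure IsTransportSolution (P : Measure Ω) (ν s : ℝ) (ξ : ℝ → Ω → ℝ) (x₀ : ℕ → ℝ)
    (a : ℕ → ℝ → Ω → ℝ) : Prop where
  aemeasurable : ∀ n t, AEMeasurable (a n t) P
  path : ∀ᵐ ω ∂P, IsTransportPath ν s (fun t => ξ t ω) x₀ (fun n t => a n t ω)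

/-- The probability law `μ` is the pull-back limit of the random variables `X s`, that is,
`X s` converges to `μ` in distribution as the starting time `s` tends to `-∞`. -/
def IsPullbackLaw (P : Measure Ω) [IsProbabilityMeasure P] (X : ℝ → Ω → ℝ)
    (μ : ProbabilityMeasure ℝ) : Prop :=
  TendstoInDistribution X atBot id (fun _ => P) (μ : Measure ℝ)

end Processes

/-- `μ` is (the law of) an `α`-stable random variable: it is non-degenerate, and for independent
copies `X, X₁, X₂` of a variable with law `μ` and all `A, B > 0`, `A X₁ + B X₂` has the law of
`(A ^ α + B ^ α) ^ (1 / α) X + D` for some real `D`. -/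
structure IsStableLaw (α : ℝ) (μ : Measure ℝ) : Prop where
  nondegenerate : ∀ x, μ ≠ Measure.dirac x
  stable : ∀ A B : ℝ, 0 < A → 0 < B → ∃ D : ℝ,
    (μ.map (fun x => A * x)).conv (μ.map (fun x => B * x)) =
      μ.map (fun x => (A ^ α + B ^ α) ^ (1 / α) * x + D)

/-! The system is linear with noise entering at site 1, so its solution is a stochastic convolution
with the response `k_n(r) = n J_n(2r) e^{-νr} / r` to a unit impulse at that site. The Bessel
recurrences give `k_n' = k_{n-1} - k_{n+1} - ν k_n` with `k_n(0) = 1` for `n = 1` and `0` otherwise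
(`hasDerivAt_transportKernel`). Since the kernel is smooth, `∫ k_n(t-u) dL(u)` needs no stochastic
calculus: integration by parts turns it into `k_n(0) L(t) + ∫ k_n'(t-u) L(u) du`, defined path by
path. This solves the system (`isTransportPath_transportPath`), and a Picard iteration in `ℓ^∞`
shows that it is the only locally bounded solution (`IsTransportPath.eq`).

The same expression is a limit of Riemann-Stieltjes sums, whose terms are independent. Hence its
characteristic function is `exp(-|z|^α σ^α ∫_0^{t-s} |k_n|^α)`, and a pull-back limit exists exactly
when `|k_n|^α` is integrable on `(0, ∞)`: if the integral diverged, the limit would vanish at every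
`z ≠ 0` and could not be continuous at `0`.

Integrability is decided by `w(r) = √r J_n(2r)`, which satisfies `w'' + (4 - (n² - 1/4)/r²) w = 0`.
Its energy `w'² + 4w²` stays between positive constants, so `w` is bounded, but `∫ w²/r` diverges.
As `k_n = n w r^{-3/2} e^{-νr}`, the integral converges if `ν > 0` or `3α/2 > 1`, and otherwise
dominates a multiple of `∫ w²/r`. No precise Bessel asymptotics are needed. -/

/-! ### Bessel power series: differentiation and recurrence. -/

/-- The entire function `G_n` with `J_n(2r) = r ^ n * G_n(r ^ 2)`. -/
noncomputable def besselG (n : ℕ) (y : ℝ) : ℝ :=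
  ∑' k : ℕ, (-1 : ℝ) ^ k / ((k ! : ℝ) * ((n + k) ! : ℝ)) * y ^ k

lemma norm_besselG_term_le (n k : ℕ) (y : ℝ) :
    ‖(-1 : ℝ) ^ k / ((k ! : ℝ) * ((n + k) ! : ℝ)) * y ^ k‖ ≤ 1 / (n ! : ℝ) * (|y| ^ k / (k ! : ℝ)) := by
  have h1 : (0 : ℝ) < k ! := by positivity
  have h2 : (0 : ℝ) < n ! := by positivity
  have h3 : (n ! : ℝ) ≤ (n + k) ! := by exact_mod_cast Nat.factorial_le (Nat.le_add_right n k)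
  rw [norm_mul, norm_div, norm_mul, norm_pow, norm_neg, norm_one, one_pow, norm_pow,
    Real.norm_eq_abs, Real.norm_eq_abs, Real.norm_eq_abs, abs_of_pos h1,
    abs_of_pos (h2.trans_le h3)]
  calc 1 / ((k ! : ℝ) * ((n + k) ! : ℝ)) * |y| ^ k
      ≤ 1 / ((k ! : ℝ) * (n ! : ℝ)) * |y| ^ k := by gcongr
    _ = _ := by field_simp

lemma summable_besselG_term (n : ℕ) (y : ℝ) :
    Summable fun k : ℕ => (-1 : ℝ) ^ k / ((k ! : ℝ) * ((n + k) ! : ℝ)) * y ^ k :=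
  Summable.of_norm_bounded ((Real.summable_pow_div_factorial |y|).mul_left _)
    fun k => norm_besselG_term_le n k y

lemma abs_besselG_le (n : ℕ) (y : ℝ) : |besselG n y| ≤ Real.exp |y| / n ! := by
  have := tsum_of_norm_bounded (((Real.summable_pow_div_factorial |y|).hasSum).mul_left
    (1 / (n ! : ℝ))) fun k => norm_besselG_term_le n k y
  rw [Real.exp_eq_exp_ℝ, NormedSpace.exp_eq_tsum_div]
  simpa [besselG, div_eq_inv_mul] using this

lemma besselJ_two_mul (n : ℕ) (r : ℝ) : besselJ n (2 * r) = r ^ n * besselG n (r ^ 2) := by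
  rw [besselJ, besselG, ← tsum_mul_left]
  refine tsum_congr fun k => ?_
  rw [mul_div_cancel_left₀ _ two_ne_zero, pow_add, pow_mul]
  ring

/-- Termwise differentiation on a ball containing `y`; the index shift `k → k + 1` moves one unit
into the order. -/
lemma hasDerivAt_besselG (n : ℕ) (y : ℝ) : HasDerivAt (besselG n) (-besselG (n + 1) y) y := by
  set R : ℝ := |y| + 1
  have hR : 0 ≤ R := by positivity
  have hterm : ∀ k : ℕ, (-1 : ℝ) ^ (k + 1) / (((k + 1) ! : ℝ) * ((n + (k + 1)) ! : ℝ)) *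
      (((k + 1 : ℕ) : ℝ) * y ^ (k + 1 - 1)) =
      -((-1 : ℝ) ^ k / ((k ! : ℝ) * ((n + 1 + k) ! : ℝ)) * y ^ k) := by
    intro k
    rw [show n + (k + 1) = n + 1 + k by ring, Nat.factorial_succ k, Nat.add_sub_cancel]
    push_cast
    have : (k + 1 : ℝ) ≠ 0 := by positivity
    field_simp
    ring
  have hsum : Summable fun k : ℕ => (k : ℝ) * R ^ (k - 1) / (k ! : ℝ) := by
    rw [← summable_nat_add_iff 1]
    refine (Real.summable_pow_div_factorial R).congr fun k => ?_
    rw [Nat.add_sub_cancel, Nat.factorial_succ]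
    push_cast
    have : (k + 1 : ℝ) ≠ 0 := by positivity
    field_simp
  have key := hasDerivAt_tsum_of_isPreconnected (y₀ := 0) (y := y)
    (g := fun (k : ℕ) (y : ℝ) => (-1 : ℝ) ^ k / ((k ! : ℝ) * ((n + k) ! : ℝ)) * y ^ k)
    (g' := fun (k : ℕ) (y : ℝ) => (-1 : ℝ) ^ k / ((k ! : ℝ) * ((n + k) ! : ℝ)) *
      ((k : ℝ) * y ^ (k - 1)))
    hsum (Metric.isOpen_ball (x := (0 : ℝ)) (ε := R))
    (convex_ball _ _).isPreconnected (fun k y _ => (hasDerivAt_pow k y).const_mul _)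
    (fun k z hz => ?_) (Metric.mem_ball_self (by positivity)) (summable_besselG_term n 0)
    (by simp [R])
  · refine key.congr_deriv ?_
    rw [Summable.tsum_eq_zero_add]
    · simp_rw [hterm, tsum_neg]
      simp [besselG]
    · rw [← summable_nat_add_iff 1]
      simp_rw [hterm]
      exact (summable_besselG_term (n + 1) y).neg
  · have hz' : |z| ≤ R := by
      rw [mem_ball_zero_iff, Real.norm_eq_abs] at hz
      exact hz.le
    have h1 : (0 : ℝ) < k ! := by positivity
    have h2 : (1 : ℝ) ≤ (n + k) ! := by exact_mod_cast (Nat.factorial_pos _)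
    rw [norm_mul, norm_div, norm_mul, norm_pow, norm_neg, norm_one, one_pow, norm_mul, norm_pow,
      Real.norm_eq_abs, Real.norm_eq_abs, Real.norm_eq_abs, Real.norm_eq_abs, abs_of_pos h1,
      abs_of_pos (zero_lt_one.trans_le h2), Nat.abs_cast]
    calc 1 / ((k ! : ℝ) * ((n + k) ! : ℝ)) * (k * |z| ^ (k - 1))
        ≤ 1 / ((k ! : ℝ) * 1) * (k * R ^ (k - 1)) := by gcongr
      _ = _ := by ring

lemma continuous_besselG (n : ℕ) : Continuous (besselG n) :=
  continuous_iff_continuousAt.2 fun y => (hasDerivAt_besselG n y).continuousAt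

lemma besselG_zero_right (n : ℕ) : besselG n 0 = 1 / n ! := by
  rw [besselG, tsum_eq_single 0]
  · simp
  · intro k hk
    simp [hk]

/-- This is `J_n + J_{n+2} = (2(n+1)/x) J_{n+1}`. On coefficients, `1/(n+k)! = ((n+1) +
k)/(n+1+k)!`, and the part carrying the factor `k` is a shifted series. -/
lemma besselG_recurrence (n : ℕ) (y : ℝ) :
    besselG n y = (n + 1) * besselG (n + 1) y - y * besselG (n + 2) y := by
  have h2 : y * besselG (n + 2) y = -∑' k : ℕ, (k : ℝ) *
      ((-1 : ℝ) ^ k / ((k ! : ℝ) * ((n + 1 + k) ! : ℝ)) * y ^ k) := by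
    have hterm : ∀ k : ℕ, ((k + 1 : ℕ) : ℝ) *
      ((-1 : ℝ) ^ (k + 1) / (((k + 1) ! : ℝ) * ((n + 1 + (k + 1)) ! : ℝ)) * y ^ (k + 1)) =
        -(y * ((-1 : ℝ) ^ k / ((k ! : ℝ) * ((n + 2 + k) ! : ℝ)) * y ^ k)) := by
      intro k
      rw [show n + 1 + (k + 1) = n + 2 + k by ring, Nat.factorial_succ k]
      push_cast
      have : (k + 1 : ℝ) ≠ 0 := by positivity
      field_simp
      ring
    rw [Summable.tsum_eq_zero_add]
    · simp_rw [hterm, tsum_neg, tsum_mul_left]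
      simp [besselG]
    · rw [← summable_nat_add_iff 1]
      simp_rw [hterm]
      exact ((summable_besselG_term (n + 2) y).mul_left y).neg
  have hterm : ∀ k : ℕ, (-1 : ℝ) ^ k / ((k ! : ℝ) * ((n + k) ! : ℝ)) * y ^ k =
      (n + 1) * ((-1 : ℝ) ^ k / ((k ! : ℝ) * ((n + 1 + k) ! : ℝ)) * y ^ k) +
      (k : ℝ) * ((-1 : ℝ) ^ k / ((k ! : ℝ) * ((n + 1 + k) ! : ℝ)) * y ^ k) := by
    intro k
    rw [show n + 1 + k = (n + k) + 1 by ring, Nat.factorial_succ (n + k)]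
    push_cast
    have : (n + k + 1 : ℝ) ≠ 0 := by positivity
    field_simp
    ring
  have hs : Summable fun k : ℕ => (k : ℝ) *
      ((-1 : ℝ) ^ k / ((k ! : ℝ) * ((n + 1 + k) ! : ℝ)) * y ^ k) := by
    refine ((summable_besselG_term n y).sub
      ((summable_besselG_term (n + 1) y).mul_left (n + 1 : ℝ))).congr fun k => ?_
    rw [hterm k]
    ring
  rw [h2, sub_neg_eq_add]
  simp only [besselG]
  rw [← tsum_mul_left, ← Summable.tsum_add ((summable_besselG_term (n + 1) y).mul_left _) hs]
  exact tsum_congr hterm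

/-! ### The impulse response: its differential system and bounds. -/

/-- The fundamental solution `n J_n(2r) e^{-ν r} / r` of the transport equation. -/
noncomputable def transportKernel (ν : ℝ) (n : ℕ) (r : ℝ) : ℝ :=
  Real.exp (-(ν * r)) * (n * r ^ (n - 1) * besselG n (r ^ 2))

/-- The derivative of `transportKernel ν n`. -/
noncomputable def transportKernelDeriv (ν : ℝ) : ℕ → ℝ → ℝ
  | 0, _ => 0
  | 1, r => -transportKernel ν 2 r - ν * transportKernel ν 1 r
  | n + 2, r => transportKernel ν (n + 1) r - transportKernel ν (n + 3) r
      - ν * transportKernel ν (n + 2) r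

lemma transportKernel_zero_left (ν r : ℝ) : transportKernel ν 0 r = 0 := by
  simp [transportKernel]

lemma transportKernel_zero_right (ν : ℝ) (n : ℕ) :
    transportKernel ν n 0 = if n = 1 then 1 else 0 := by
  rcases n with - | - | n
  · simp [transportKernel]
  · simp [transportKernel, besselG_zero_right]
  · simp [transportKernel]

lemma hasDerivAt_besselG_sq (n : ℕ) (r : ℝ) :
    HasDerivAt (fun r => besselG n (r ^ 2)) (-(2 * r * besselG (n + 1) (r ^ 2))) r := by
  refine ((hasDerivAt_besselG n (r ^ 2)).comp r (hasDerivAt_pow 2 r)).congr_deriv ?_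
  push_cast
  ring

lemma hasDerivAt_transportKernel (ν : ℝ) (n : ℕ) (r : ℝ) :
    HasDerivAt (transportKernel ν n) (transportKernelDeriv ν n r) r := by
  have he : HasDerivAt (fun r => Real.exp (-(ν * r))) (-ν * Real.exp (-(ν * r))) r := by
    refine ((hasDerivAt_id' r).const_mul ν).fun_neg.exp.congr_deriv ?_
    ring
  have h := he.mul (((hasDerivAt_pow (n - 1) r).const_mul (n : ℝ)).mul (hasDerivAt_besselG_sq n r))
  refine h.congr_deriv ?_
  rcases n with - | - | m
  · simp [transportKernelDeriv]
  · simp [transportKernel, transportKernelDeriv]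
    ring
  · simp only [transportKernel, transportKernelDeriv, show m + 2 - 1 = m + 1 by omega,
      show m + 1 - 1 = m by omega, show m + 3 - 1 = m + 2 by omega]
    rw [besselG_recurrence (m + 1) (r ^ 2)]
    push_cast
    simp only [Pi.mul_apply, show m + 1 + 1 = m + 2 by omega,
      show m + 1 + 2 = m + 3 by omega]
    ring

lemma continuous_transportKernel (ν : ℝ) (n : ℕ) : Continuous (transportKernel ν n) :=
  continuous_iff_continuousAt.2 fun r => (hasDerivAt_transportKernel ν n r).continuousAt

lemma continuous_transportKernelDeriv (ν : ℝ) (n : ℕ) : Continuous (transportKernelDeriv ν n) := by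
  have h := continuous_transportKernel ν
  rcases n with - | - | n
  · exact continuous_const
  · exact (h 2).neg.sub ((h 1).const_mul ν)
  · exact ((h (n + 1)).sub (h (n + 3))).sub ((h (n + 2)).const_mul ν)

/-- Crude in `r`, but uniform in `n`, as membership in the class of solutions locally bounded in
`ℓ^∞` requires. -/
lemma abs_transportKernel_le {ν r : ℝ} (hν : 0 ≤ ν) (hr : 0 ≤ r) (n : ℕ) :
    |transportKernel ν n r| ≤ Real.exp (r + r ^ 2) := by
  rcases n with - | n
  · simp [transportKernel, Real.exp_nonneg]
  have h1 : r ^ n / n ! ≤ Real.exp r := Real.pow_div_factorial_le_exp r hr n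
  have h2 := abs_besselG_le (n + 1) (r ^ 2)
  have h3 : Real.exp (-(ν * r)) ≤ 1 := Real.exp_le_one_iff.2 (by nlinarith)
  rw [transportKernel, abs_mul, abs_mul, abs_mul, Real.abs_exp, Nat.abs_cast, Nat.add_sub_cancel,
    abs_of_nonneg (pow_nonneg hr n), Real.exp_add]
  rw [abs_of_nonneg (sq_nonneg r)] at h2
  calc Real.exp (-(ν * r)) * (((n + 1 : ℕ) : ℝ) * r ^ n * |besselG (n + 1) (r ^ 2)|)
      ≤ 1 * (((n + 1 : ℕ) : ℝ) * r ^ n * (Real.exp (r ^ 2) / (n + 1) !)) := by gcongr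
    _ = r ^ n / n ! * Real.exp (r ^ 2) := by
        rw [Nat.factorial_succ]
        push_cast
        have : (n + 1 : ℝ) ≠ 0 := by positivity
        field_simp
    _ ≤ _ := by gcongr

lemma abs_transportKernelDeriv_le {ν r : ℝ} (hν : 0 ≤ ν) (hr : 0 ≤ r) (n : ℕ) :
    |transportKernelDeriv ν n r| ≤ (2 + ν) * Real.exp (r + r ^ 2) := by
  have h := fun n => abs_le.1 (abs_transportKernel_le hν hr n)
  have he := Real.exp_nonneg (r + r ^ 2)
  rw [abs_le]
  rcases n with - | - | n <;> simp only [transportKernelDeriv]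
  · constructor <;> nlinarith
  · constructor <;> nlinarith [h 1, h 2]
  · constructor <;> nlinarith [h (n + 1), h (n + 2), h (n + 3)]

lemma abs_transportKernel_rpow {ν r : ℝ} (α : ℝ) (n : ℕ) (hn : 1 ≤ n) (hr : 0 < r) :
    |transportKernel ν n r| ^ α =
      (n : ℝ) ^ α * (|besselJ n (2 * r)| ^ α / r ^ α * Real.exp (-(α * ν * r))) := by
  have h : transportKernel ν n r = Real.exp (-(ν * r)) * (n * (besselJ n (2 * r) / r)) := by
    obtain ⟨m, rfl⟩ : ∃ m, n = m + 1 := ⟨n - 1, by omega⟩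
    rw [besselJ_two_mul, transportKernel, Nat.add_sub_cancel]
    field_simp
    ring
  rw [h, abs_mul, abs_mul, Real.abs_exp, Nat.abs_cast, abs_div, abs_of_pos hr,
    Real.mul_rpow (Real.exp_nonneg _) (by positivity), Real.mul_rpow (by positivity) (by positivity),
    Real.div_rpow (abs_nonneg _) hr.le, ← Real.exp_mul]
  ring_nf

/-! ### Large-argument behaviour of Bessel functions by energy estimates. -/

/-- The function `√r J_n(2r)`. -/
noncomputable def besselWave (n : ℕ) (r : ℝ) : ℝ := √r * (r ^ n * besselG n (r ^ 2))

/-- The derivative of `besselWave n` on `(0, ∞)`. -/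
noncomputable def besselWaveDeriv (n : ℕ) (r : ℝ) : ℝ :=
  √r * ((n + 1 / 2) / r * (r ^ n * besselG n (r ^ 2)) - 2 * (r ^ (n + 1) * besselG (n + 1) (r ^ 2)))

lemma hasDerivAt_pow_mul_besselG (n : ℕ) {r : ℝ} (hr : 0 < r) :
    HasDerivAt (fun r => r ^ n * besselG n (r ^ 2))
      (n / r * (r ^ n * besselG n (r ^ 2)) - 2 * (r ^ (n + 1) * besselG (n + 1) (r ^ 2))) r := by
  refine ((hasDerivAt_pow n r).fun_mul (hasDerivAt_besselG_sq n r)).congr_deriv ?_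
  rcases n with - | n
  · simp
    ring
  · rw [Nat.add_sub_cancel]
    field_simp
    ring

lemma hasDerivAt_pow_mul_besselG_succ (n : ℕ) {r : ℝ} (hr : 0 < r) :
    HasDerivAt (fun r => r ^ (n + 1) * besselG (n + 1) (r ^ 2))
      (2 * (r ^ n * besselG n (r ^ 2)) -
        (n + 1) / r * (r ^ (n + 1) * besselG (n + 1) (r ^ 2))) r := by
  refine (hasDerivAt_pow_mul_besselG (n + 1) hr).congr_deriv ?_
  rw [besselG_recurrence n (r ^ 2)]
  push_cast
  field_simp
  ring

lemma hasDerivAt_besselWave (n : ℕ) {r : ℝ} (hr : 0 < r) :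
    HasDerivAt (besselWave n) (besselWaveDeriv n r) r := by
  refine ((Real.hasDerivAt_sqrt hr.ne').fun_mul (hasDerivAt_pow_mul_besselG n hr)).congr_deriv ?_
  have h : √r * √r = r := Real.mul_self_sqrt hr.le
  have hs : 0 < √r := Real.sqrt_pos.2 hr
  have h1 : 1 / (2 * √r) = √r * (1 / 2 / r) := by
    field_simp
    nlinarith
  rw [besselWaveDeriv, h1]
  ring

/-- The factor `√r` removes the first-order term of Bessel's equation and leaves an oscillator of
frequency 2 perturbed by an `O(r⁻²)` potential. -/
lemma hasDerivAt_besselWaveDeriv (n : ℕ) {r : ℝ} (hr : 0 < r) :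
    HasDerivAt (besselWaveDeriv n)
      (-(4 - ((n : ℝ) ^ 2 - 1 / 4) / r ^ 2) * besselWave n r) r := by
  have hc : HasDerivAt (fun r : ℝ => ((n : ℝ) + 1 / 2) / r) (-((n : ℝ) + 1 / 2) / r ^ 2) r := by
    refine ((hasDerivAt_const r ((n : ℝ) + 1 / 2)).fun_div (hasDerivAt_id' r) hr.ne').congr_deriv ?_
    ring
  refine ((Real.hasDerivAt_sqrt hr.ne').fun_mul
    ((hc.fun_mul (hasDerivAt_pow_mul_besselG n hr)).fun_sub
      ((hasDerivAt_pow_mul_besselG_succ n hr).const_mul 2))).congr_deriv ?_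
  have h : √r * √r = r := Real.mul_self_sqrt hr.le
  have hs : 0 < √r := Real.sqrt_pos.2 hr
  have h1 : 1 / (2 * √r) = √r * (1 / 2 / r) := by
    field_simp
    nlinarith
  rw [besselWave, h1]
  generalize r ^ n * besselG n (r ^ 2) = p
  generalize r ^ (n + 1) * besselG (n + 1) (r ^ 2) = q
  field_simp
  ring

/-- Energy bounds for `w'' + (4 - c / r ^ 2) w = 0`. -/
lemma energy_bounds {w v : ℝ → ℝ} {c r₀ : ℝ} (hr₀ : 0 < r₀)
    (hw : ∀ r, 0 < r → HasDerivAt w (v r) r)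
    (hv : ∀ r, 0 < r → HasDerivAt v (-(4 - c / r ^ 2) * w r) r) {r : ℝ} (hr : r₀ ≤ r) :
    (v r₀ ^ 2 + 4 * w r₀ ^ 2) * Real.exp (-(|c| / r₀)) ≤ v r ^ 2 + 4 * w r ^ 2 ∧
      v r ^ 2 + 4 * w r ^ 2 ≤ (v r₀ ^ 2 + 4 * w r₀ ^ 2) * Real.exp (|c| / r₀) := by
  set E : ℝ → ℝ := fun r => v r ^ 2 + 4 * w r ^ 2 with hEdef
  -- The oscillator terms cancel, so `|E'| ≤ |c| E / r²`. This rate is integrable at infinity, and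
  -- the factors `exp(∓|c|/r)` make `E` monotone.
  have hE : ∀ r, 0 < r → HasDerivAt E (2 * c * (v r * w r) / r ^ 2) r := by
    intro r hr
    refine (((hv r hr).fun_pow 2).fun_add (((hw r hr).fun_pow 2).const_mul 4)).congr_deriv ?_
    push_cast
    field_simp
    ring
  have hexp : ∀ a r : ℝ, 0 < r →
      HasDerivAt (fun r => Real.exp (a / r)) (-(a / r ^ 2) * Real.exp (a / r)) r := by
    intro a r hr
    refine ((hasDerivAt_const r a).fun_div (hasDerivAt_id' r) hr.ne').exp.congr_deriv ?_
    ring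
  have hbd : ∀ r, |2 * c * (v r * w r)| ≤ |c| * E r := by
    intro r
    rw [mul_comm (2 : ℝ), mul_assoc, abs_mul]
    refine mul_le_mul_of_nonneg_left ?_ (abs_nonneg c)
    rw [abs_le]
    constructor <;> simp only [hEdef] <;> nlinarith [sq_nonneg (v r + w r), sq_nonneg (v r - w r),
      sq_nonneg (w r)]
  have hr0 : 0 < r := hr₀.trans_le hr
  have hE0 : 0 ≤ E r₀ := by positivity
  have hEr : 0 ≤ E r := by positivity
  have hI : interior (Ici r₀) ⊆ Ioi 0 := by
    rw [interior_Ici]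
    exact Ioi_subset_Ioi hr₀.le
  constructor
  · have hmono : MonotoneOn (fun r => E r * Real.exp (-|c| / r)) (Ici r₀) := by
      refine monotoneOn_of_hasDerivWithinAt_nonneg (convex_Ici r₀) (fun x hx => ?_)
        (fun x hx => ((hE x (hI hx)).fun_mul (hexp (-|c|) x (hI hx))).hasDerivWithinAt)
        (fun x hx => ?_)
      · have hx : 0 < x := hr₀.trans_le hx
        exact ((hE x hx).fun_mul (hexp (-|c|) x hx)).continuousAt.continuousWithinAt
      · have hx : 0 < x := hI hx
        have : 2 * c * (v x * w x) / x ^ 2 * Real.exp (-|c| / x) +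
            E x * (-(-|c| / x ^ 2) * Real.exp (-|c| / x)) =
            (2 * c * (v x * w x) + |c| * E x) / x ^ 2 * Real.exp (-|c| / x) := by ring
        rw [this]
        have := neg_le_of_abs_le (hbd x)
        exact mul_nonneg (div_nonneg (by linarith) (by positivity)) (Real.exp_nonneg _)
    have h := hmono self_mem_Ici hr hr
    have h1 : Real.exp (-|c| / r) ≤ 1 := by
      rw [Real.exp_le_one_iff, neg_div]
      exact neg_nonpos.2 (by positivity)
    rw [← neg_div]
    exact h.trans (mul_le_of_le_one_right hEr h1)
  · have hanti : AntitoneOn (fun r => E r * Real.exp (|c| / r)) (Ici r₀) := by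
      refine antitoneOn_of_hasDerivWithinAt_nonpos (convex_Ici r₀) (fun x hx => ?_)
        (fun x hx => ((hE x (hI hx)).fun_mul (hexp |c| x (hI hx))).hasDerivWithinAt)
        (fun x hx => ?_)
      · have hx : 0 < x := hr₀.trans_le hx
        exact ((hE x hx).fun_mul (hexp |c| x hx)).continuousAt.continuousWithinAt
      · have hx : 0 < x := hI hx
        have : 2 * c * (v x * w x) / x ^ 2 * Real.exp (|c| / x) +
            E x * (-(|c| / x ^ 2) * Real.exp (|c| / x)) =
            (2 * c * (v x * w x) - |c| * E x) / x ^ 2 * Real.exp (|c| / x) := by ring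
        rw [this]
        have := le_of_abs_le (hbd x)
        exact mul_nonpos_of_nonpos_of_nonneg
          (div_nonpos_of_nonpos_of_nonneg (by linarith) (by positivity)) (Real.exp_nonneg _)
    have h := hanti self_mem_Ici hr hr
    have h1 : 1 ≤ Real.exp (|c| / r) := Real.one_le_exp (by positivity)
    exact (le_mul_of_one_le_right hEr h1).trans h

/-- The energy of `√r J_n(2r)` stays between two positive constants. -/
lemma exists_besselWave_energy_bounds (n : ℕ) : ∃ r₀ m M : ℝ, 1 ≤ r₀ ∧ 0 < m ∧ 0 < M ∧
    ∀ r, r₀ ≤ r → m ≤ besselWaveDeriv n r ^ 2 + 4 * besselWave n r ^ 2 ∧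
      besselWaveDeriv n r ^ 2 + 4 * besselWave n r ^ 2 ≤ M := by
  -- The lower energy bound needs one point of nonzero energy; near the origin `G_n` is close to
  -- `1/n!`.
  have h1 : ∀ᶠ r : ℝ in 𝓝[>] 0, 0 < besselG n (r ^ 2) := by
    have : Tendsto (fun r : ℝ => besselG n (r ^ 2)) (𝓝[>] 0) (𝓝 (besselG n (0 ^ 2))) :=
      ((continuous_besselG n).comp (continuous_pow 2)).continuousAt.tendsto.mono_left
        nhdsWithin_le_nhds
    refine this.eventually_const_lt ?_
    rw [zero_pow two_ne_zero, besselG_zero_right]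
    positivity
  obtain ⟨r₁, hG, hr₁⟩ := (h1.and self_mem_nhdsWithin).exists
  have hr₁ : 0 < r₁ := hr₁
  have hw : 0 < besselWave n r₁ := by
    unfold besselWave
    positivity
  have hE : 0 < besselWaveDeriv n r₁ ^ 2 + 4 * besselWave n r₁ ^ 2 := by positivity
  refine ⟨max 1 r₁, _, _, le_max_left _ _, mul_pos hE (Real.exp_pos _), mul_pos hE (Real.exp_pos _),
    fun r hr => energy_bounds hr₁ (fun r hr => hasDerivAt_besselWave n hr)
      (fun r hr => hasDerivAt_besselWaveDeriv n hr) ((le_max_right _ _).trans hr)⟩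

/-- Solutions of `w'' + (4 - c / r ^ 2) w = 0` of bounded energy are not square integrable with
respect to `dr / r`. -/
lemma not_integrableOn_sq_div {w v : ℝ → ℝ} {c r₀ m M : ℝ} (hr₀ : 1 ≤ r₀) (hm : 0 < m)
    (hw : ∀ r, 0 < r → HasDerivAt w (v r) r)
    (hv : ∀ r, 0 < r → HasDerivAt v (-(4 - c / r ^ 2) * w r) r)
    (hE : ∀ r, r₀ ≤ r → m ≤ v r ^ 2 + 4 * w r ^ 2 ∧ v r ^ 2 + 4 * w r ^ 2 ≤ M) :
    ¬ IntegrableOn (fun r => w r ^ 2 / r) (Ioi r₀) := by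
  intro hint
  have hpos : ∀ x, r₀ ≤ x → 0 < x := fun x hx => by linarith
  have hM : 0 < M := hm.trans_le ((hE r₀ le_rfl).1.trans (hE r₀ le_rfl).2)
  set I := ∫ r in Ioi r₀, w r ^ 2 / r
  have hcont : ContinuousOn (fun r => w r ^ 2 / r) (Ici r₀) := fun x hx =>
    (((hw x (hpos x hx)).continuousAt.pow 2).div continuousAt_id
      (hpos x hx).ne').continuousWithinAt
  -- Equipartition: `(vw/x)' = (v² - 4w²)/x + O(x⁻²)`, so `8 ∫ w²/r + vw/x` has derivative at least
  -- `m/x - D/x²`. Subtracting `m log x` and `D/x` makes `F` increasing, so a finite integral would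
  -- bound `m log x`.
  set D : ℝ := (|c| + 1) * M
  set F : ℝ → ℝ := fun x => 8 * (∫ r in r₀..x, w r ^ 2 / r) + v x * w x / x - m * Real.log x - D / x
  have hderiv : ∀ x, r₀ < x → HasDerivAt F (8 * (w x ^ 2 / x) +
      ((-(4 - c / x ^ 2) * w x * w x + v x * v x) * x - v x * w x * 1) / x ^ 2 - m * x⁻¹ -
      (0 * x - D * 1) / x ^ 2) x := by
    intro x hx
    have hx0 := hpos x hx.le
    have hi : HasDerivAt (fun x => ∫ r in r₀..x, w r ^ 2 / r) (w x ^ 2 / x) x := by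
      refine intervalIntegral.integral_hasDerivAt_right ?_ ?_ ?_
      · exact (hcont.mono (by rw [uIcc_of_le hx.le]; exact Icc_subset_Ici_self)).intervalIntegrable
      · exact (hcont.mono Ioi_subset_Ici_self).stronglyMeasurableAtFilter isOpen_Ioi x hx
      · exact (hcont x hx.le).continuousAt (Ici_mem_nhds hx)
    exact (((hi.const_mul 8).fun_add (((hv x hx0).fun_mul (hw x hx0)).fun_div (hasDerivAt_id' x)
      hx0.ne')).fun_sub ((Real.hasDerivAt_log hx0.ne').const_mul m)).fun_sub
      ((hasDerivAt_const x D).fun_div (hasDerivAt_id' x) hx0.ne')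
  have hFc : ContinuousOn F (Ici r₀) := by
    have hi : ContinuousOn (fun x => ∫ r in r₀..x, w r ^ 2 / r) (Ici r₀) := by
      intro x hx
      have hx1 : r₀ ≤ x := hx
      have := intervalIntegral.continuousOn_primitive_interval (μ := volume)
        (f := fun r => w r ^ 2 / r) (a := r₀) (b := x + 1) (by
          rw [uIcc_of_le (by linarith)]
          exact (hcont.mono Icc_subset_Ici_self).integrableOn_Icc)
      rw [uIcc_of_le (by linarith)] at this
      refine (this x ⟨hx1, by linarith⟩).mono_of_mem_nhdsWithin ?_
      rw [mem_nhdsWithin]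
      exact ⟨Iio (x + 1), isOpen_Iio, by simp, fun y hy => ⟨hy.2, hy.1.le⟩⟩
    have hvw : ContinuousOn (fun x => v x * w x / x) (Ici r₀) := fun x hx =>
      (((hv x (hpos x hx)).continuousAt.mul (hw x (hpos x hx)).continuousAt).div continuousAt_id
        (hpos x hx).ne').continuousWithinAt
    have hlog : ContinuousOn Real.log (Ici r₀) := fun x hx =>
      (Real.continuousAt_log (hpos x hx).ne').continuousWithinAt
    have hinv : ContinuousOn (fun x => D / x) (Ici r₀) := fun x hx =>
      (continuousAt_const.div continuousAt_id (hpos x hx).ne').continuousWithinAt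
    exact (((hi.const_mul 8).add hvw).sub (hlog.const_mul m)).sub hinv
  have hvw : ∀ x, r₀ ≤ x → |v x * w x| ≤ M := by
    intro x hx
    have := (hE x hx).2
    rw [abs_le]
    constructor <;> nlinarith [sq_nonneg (v x + w x), sq_nonneg (v x - w x), sq_nonneg (w x)]
  have hmono : MonotoneOn F (Ici r₀) := by
    refine monotoneOn_of_hasDerivWithinAt_nonneg (convex_Ici r₀) hFc
      (fun x hx => (hderiv x (by simpa using hx)).hasDerivWithinAt) (fun x hx => ?_)
    rw [interior_Ici] at hx
    have hx1 : r₀ ≤ x := hx.le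
    have hx0 := hpos x hx1
    have hx1' : 1 ≤ x := hr₀.trans hx1
    have e : 8 * (w x ^ 2 / x) +
      ((-(4 - c / x ^ 2) * w x * w x + v x * v x) * x - v x * w x * 1) / x ^ 2 - m * x⁻¹ -
      (0 * x - D * 1) / x ^ 2 = (v x ^ 2 + 4 * w x ^ 2 - m) / x +
        (c * w x ^ 2 / x - v x * w x + D) / x ^ 2 := by
      field_simp
      ring
    rw [e]
    have h1 := (hE x hx1).1
    have h2 := le_of_abs_le (hvw x hx1)
    have h3 : |c * w x ^ 2 / x| ≤ |c| * M := by
      rw [abs_div, abs_mul, abs_of_pos hx0, abs_of_nonneg (sq_nonneg (w x))]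
      refine (div_le_self (by positivity) hx1').trans ?_
      refine mul_le_mul_of_nonneg_left ?_ (abs_nonneg c)
      nlinarith [(hE x hx1).2, sq_nonneg (v x), sq_nonneg (w x)]
    have h4 := neg_le_of_abs_le h3
    refine add_nonneg (div_nonneg (by linarith) hx0.le) (div_nonneg ?_ (by positivity))
    simp only [D]
    linarith
  have hI : ∀ x, r₀ ≤ x → ∫ r in r₀..x, w r ^ 2 / r ≤ I := by
    intro x hx
    rw [intervalIntegral.integral_of_le hx]
    refine setIntegral_mono_set hint ?_ (Ioc_subset_Ioi_self.eventuallyLE)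
    filter_upwards [ae_restrict_mem measurableSet_Ioi] with r hr
    have := hpos r (le_of_lt hr)
    simp only [Pi.zero_apply]
    positivity
  have hup : ∀ x, r₀ ≤ x → m * Real.log x ≤ 8 * I + M - F r₀ := by
    intro x hx
    have h1 := hmono self_mem_Ici hx hx
    have h2 := hI x hx
    have hx0 := hpos x hx
    have h3 : v x * w x / x ≤ M :=
      (le_abs_self _).trans (by
        rw [abs_div, abs_of_pos hx0]
        exact (div_le_self (abs_nonneg _) (hr₀.trans hx)).trans (hvw x hx))
    have h4 : 0 ≤ D / x := by positivity
    simp only [F] at h1 ⊢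
    linarith
  have hlog : Tendsto (fun x => m * Real.log x) atTop atTop :=
    Real.tendsto_log_atTop.const_mul_atTop hm
  obtain ⟨x, hx1, hx2⟩ := ((hlog.eventually_gt_atTop (8 * I + M - F r₀)).and
    (eventually_ge_atTop r₀)).exists
  exact (hup x hx2).not_gt hx1

/-! ### Integrability of the `α`-th power of the kernel. -/

lemma transportKernel_eq_besselWave {n : ℕ} (hn : 1 ≤ n) (ν : ℝ) {r : ℝ} (hr : 0 < r) :
    transportKernel ν n r = Real.exp (-(ν * r)) * (n * besselWave n r * r ^ (-(3 / 2) : ℝ)) := by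
  obtain ⟨m, rfl⟩ : ∃ m, n = m + 1 := ⟨n - 1, by omega⟩
  have h : √r * r ^ (-(3 / 2) : ℝ) = r⁻¹ := by
    rw [Real.sqrt_eq_rpow, ← Real.rpow_add hr, ← Real.rpow_neg_one]
    norm_num
  rw [transportKernel, besselWave, Nat.add_sub_cancel]
  calc _ = Real.exp (-(ν * r)) * (((m + 1 : ℕ) : ℝ) * (r ^ (m + 1) * r⁻¹) *
      besselG (m + 1) (r ^ 2)) := by
        rw [pow_succ r m, mul_assoc (r ^ m), mul_inv_cancel₀ hr.ne', mul_one]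
    _ = _ := by
        rw [← h]
        ring

/-- The integral of `|k_n| ^ α` converges if `ν > 0` or `α > 2 / 3`. -/
lemma integrableOn_transportKernel_rpow {ν α : ℝ} (hν : 0 ≤ ν) (hα : 0 < α)
    (h : 0 < ν ∨ 2 / 3 < α) {n : ℕ} (hn : 1 ≤ n) :
    IntegrableOn (fun r => |transportKernel ν n r| ^ α) (Ioi 0) := by
  have hcont : Continuous fun r => |transportKernel ν n r| ^ α :=
    (continuous_transportKernel ν n).abs.rpow_const fun _ => Or.inr hα.le
  obtain ⟨r₀, m, M, hr₀, hm, hM, hE⟩ := exists_besselWave_energy_bounds n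
  have hW : ∀ r, r₀ ≤ r → |besselWave n r| ≤ √M := by
    intro r hr
    rw [← Real.sqrt_sq_eq_abs]
    refine Real.sqrt_le_sqrt ?_
    nlinarith [(hE r hr).2, sq_nonneg (besselWaveDeriv n r), sq_nonneg (besselWave n r)]
  have hle : ∀ r ∈ Ioi r₀, |transportKernel ν n r| ^ α ≤
      (n * √M) ^ α * (Real.exp (-(ν * α * r)) * r ^ (-(3 / 2 * α))) := by
    intro r hr
    have hr0 : 0 < r := by
      have : r₀ < r := hr
      linarith
    have h1 : |transportKernel ν n r| ≤
        n * √M * (Real.exp (-(ν * r)) * r ^ (-(3 / 2) : ℝ)) := by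
      rw [transportKernel_eq_besselWave hn ν hr0, abs_mul, abs_mul, abs_mul, Real.abs_exp,
        Nat.abs_cast, abs_of_pos (Real.rpow_pos_of_pos hr0 _)]
      have := hW r (le_of_lt hr)
      have h2 : 0 < r ^ (-(3 / 2) : ℝ) := Real.rpow_pos_of_pos hr0 _
      calc _ ≤ Real.exp (-(ν * r)) * (n * √M * r ^ (-(3 / 2) : ℝ)) := by gcongr
        _ = _ := by ring
    refine (Real.rpow_le_rpow (abs_nonneg _) h1 hα.le).trans_eq ?_
    rw [Real.mul_rpow (by positivity) (by positivity),
      Real.mul_rpow (Real.exp_nonneg _) (by positivity), ← Real.exp_mul, ← Real.rpow_mul hr0.le]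
    ring_nf
  have hr₀' : 0 < r₀ := by linarith
  have hdom : IntegrableOn (fun r => Real.exp (-(ν * α * r)) * r ^ (-(3 / 2 * α))) (Ioi r₀) := by
    have hmeas : AEStronglyMeasurable (fun r : ℝ => Real.exp (-(ν * α * r)) * r ^ (-(3 / 2 * α)))
        (volume.restrict (Ioi r₀)) := by
      refine Measurable.aestronglyMeasurable ?_
      fun_prop
    -- Either the exponential alone gives convergence, or the power does since `3α/2 > 1`.
    rcases h with h | h
    · have hint : IntegrableOn (fun r => Real.exp (-(ν * α) * r)) (Ioi r₀) :=
        integrableOn_exp_mul_Ioi (by nlinarith [mul_pos h hα]) r₀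
      refine hint.mono' hmeas ?_
      filter_upwards [ae_restrict_mem measurableSet_Ioi] with r hr
      have hr1 : 1 ≤ r := hr₀.trans (le_of_lt hr)
      rw [Real.norm_eq_abs, abs_of_nonneg (by positivity), neg_mul]
      refine mul_le_of_le_one_right (Real.exp_nonneg _) ?_
      exact Real.rpow_le_one_of_one_le_of_nonpos hr1 (by linarith)
    · have hint : IntegrableOn (fun r : ℝ => r ^ (-(3 / 2 * α))) (Ioi r₀) :=
        integrableOn_Ioi_rpow_of_lt (by linarith) hr₀'
      refine hint.mono' hmeas ?_
      filter_upwards [ae_restrict_mem measurableSet_Ioi] with r hr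
      have hr1 : 0 ≤ r := hr₀'.le.trans (le_of_lt hr)
      rw [Real.norm_eq_abs, abs_of_nonneg (by positivity)]
      refine mul_le_of_le_one_left (by positivity) ?_
      rw [Real.exp_le_one_iff]
      have : 0 ≤ ν * α * r := by positivity
      linarith
  rw [← Ioc_union_Ioi_eq_Ioi hr₀'.le]
  refine IntegrableOn.union (hcont.integrableOn_Icc.mono_set Ioc_subset_Icc_self) ?_
  refine (hdom.const_mul ((n * √M) ^ α)).mono' hcont.aestronglyMeasurable ?_
  filter_upwards [ae_restrict_mem measurableSet_Ioi] with r hr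
  rw [Real.norm_eq_abs, abs_of_nonneg (by positivity)]
  exact hle r hr

/-- The integral of `|k_n| ^ α` diverges if `ν = 0` and `α ≤ 2 / 3`. -/
lemma not_integrableOn_transportKernel_rpow {α : ℝ} (hα : 0 < α) (h : α ≤ 2 / 3) {n : ℕ}
    (hn : 1 ≤ n) : ¬ IntegrableOn (fun r => |transportKernel 0 n r| ^ α) (Ioi 0) := by
  intro hint
  obtain ⟨r₀, m, M, hr₀, hm, hM, hE⟩ := exists_besselWave_energy_bounds n
  have hpos : ∀ x, r₀ ≤ x → 0 < x := fun x hx => by linarith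
  have hW : ∀ r, r₀ ≤ r → |besselWave n r| ≤ √M := by
    intro r hr
    rw [← Real.sqrt_sq_eq_abs]
    refine Real.sqrt_le_sqrt ?_
    nlinarith [(hE r hr).2, sq_nonneg (besselWaveDeriv n r), sq_nonneg (besselWave n r)]
  refine not_integrableOn_sq_div hr₀ hm (fun r hr => hasDerivAt_besselWave n hr)
    (fun r hr => hasDerivAt_besselWaveDeriv n hr) hE ?_
  have hn0 : (1 : ℝ) ≤ n := by exact_mod_cast hn
  refine ((hint.mono_set (Ioi_subset_Ioi (by linarith))).const_mul (√M ^ (2 - α))).mono' ?_ ?_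
  · refine ContinuousOn.aestronglyMeasurable (fun x hx => ?_) measurableSet_Ioi
    have hx := hpos x (le_of_lt hx)
    exact (((hasDerivAt_besselWave n hx).continuousAt.pow 2).div continuousAt_id
      hx.ne').continuousWithinAt
  · filter_upwards [ae_restrict_mem measurableSet_Ioi] with r hr
    have hr1 : r₀ ≤ r := le_of_lt hr
    have hr0 := hpos r hr1
    have hw0 := abs_nonneg (besselWave n r)
    rw [Real.norm_eq_abs, abs_of_nonneg (by positivity), transportKernel_eq_besselWave hn 0 hr0,
      zero_mul, neg_zero, Real.exp_zero, one_mul, abs_mul, abs_mul, Nat.abs_cast,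
      abs_of_pos (Real.rpow_pos_of_pos hr0 _), Real.mul_rpow (by positivity) (by positivity),
      Real.mul_rpow (by positivity) (by positivity), ← Real.rpow_mul hr0.le]
    have h1 : (1 : ℝ) ≤ (n : ℝ) ^ α := Real.one_le_rpow hn0 hα.le
    have h2 : r⁻¹ ≤ r ^ (-(3 / 2) * α) := by
      rw [← Real.rpow_neg_one]
      exact Real.rpow_le_rpow_of_exponent_le (hr₀.trans hr1) (by linarith)
    -- Boundedness of the wave trades the exponent `2` for `α`; together with `r⁻¹ ≤ r^{-3α/2}`,
    -- where `α ≤ 2/3` enters, this gives the comparison with `∫ w²/r`.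
    have h3 : besselWave n r ^ 2 ≤ √M ^ (2 - α) * |besselWave n r| ^ α := by
      have e : besselWave n r ^ 2 = |besselWave n r| ^ (2 - α) * |besselWave n r| ^ α := by
        rw [← Real.rpow_add_of_nonneg hw0 (by linarith) hα.le, ← sq_abs]
        norm_num
      rw [e]
      gcongr
      · linarith
      · exact hW r hr1
    calc besselWave n r ^ 2 / r = besselWave n r ^ 2 * r⁻¹ := by ring
      _ ≤ (√M ^ (2 - α) * |besselWave n r| ^ α) * r ^ (-(3 / 2) * α) := by gcongr
      _ ≤ (√M ^ (2 - α) * ((n : ℝ) ^ α * |besselWave n r| ^ α)) * r ^ (-(3 / 2) * α) := by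
          gcongr
          exact le_mul_of_one_le_left (by positivity) h1
      _ = _ := by ring

/-- The integral of `|k_n| ^ α` is positive. -/
lemma integral_transportKernel_rpow_pos {ν α : ℝ} {n : ℕ} (hn : 1 ≤ n)
    (hint : IntegrableOn (fun r => |transportKernel ν n r| ^ α) (Ioi 0)) :
    0 < ∫ r in Ioi 0, |transportKernel ν n r| ^ α := by
  rw [setIntegral_pos_iff_support_of_nonneg_ae
    (ae_of_all _ fun r => Real.rpow_nonneg (abs_nonneg _) _) hint]
  have h1 : ∀ᶠ r : ℝ in 𝓝 0, 0 < besselG n (r ^ 2) := by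
    have : Tendsto (fun r : ℝ => besselG n (r ^ 2)) (𝓝 0) (𝓝 (besselG n (0 ^ 2))) :=
      ((continuous_besselG n).comp (continuous_pow 2)).continuousAt.tendsto
    refine this.eventually_const_lt ?_
    rw [zero_pow two_ne_zero, besselG_zero_right]
    positivity
  obtain ⟨ε, hε, hball⟩ := Metric.eventually_nhds_iff.1 h1
  have hsub : Ioo 0 ε ⊆ (Function.support fun r => |transportKernel ν n r| ^ α) ∩ Ioi 0 := by
    rintro r ⟨hr, hr'⟩
    have hG := hball (show dist r 0 < ε by simpa [abs_of_pos hr] using hr')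
    have hn0 : (0 : ℝ) < n := by exact_mod_cast hn
    have : 0 < transportKernel ν n r := by
      unfold transportKernel
      positivity
    exact ⟨(Real.rpow_pos_of_pos (abs_pos.2 this.ne') α).ne', hr⟩
  refine lt_of_lt_of_le ?_ (measure_mono hsub)
  simpa using hε

/-! ### Deterministic well-posedness: uniqueness and the Duhamel formula. -/

/-- The transport equation has at most one locally bounded path. -/
lemma IsTransportPath.eq {ν s : ℝ} {ℓ : ℝ → ℝ} {x₀ : ℕ → ℝ} {x y : ℕ → ℝ → ℝ} (hν : 0 ≤ ν)
    (hx : IsTransportPath ν s ℓ x₀ x) (hy : IsTransportPath ν s ℓ x₀ y) (n : ℕ) {t : ℝ}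
    (ht : s ≤ t) : x n t = y n t := by
  obtain ⟨C₁, hC₁⟩ := hx.bounded t ht
  obtain ⟨C₂, hC₂⟩ := hy.bounded t ht
  set C := C₁ + C₂
  set M := 2 + ν
  have hM : 0 ≤ M := by positivity
  have hbase : ∀ n, ∀ r ∈ Icc s t, |x n r - y n r| ≤ C := fun n r hr =>
    (abs_sub _ _).trans (add_le_add (hC₁ n r hr) (hC₂ n r hr))
  have hC : 0 ≤ C := (abs_nonneg _).trans (hbase 0 t ⟨ht, le_rfl⟩)
  -- Picard iteration: `M = 2 + ν` bounds the right-hand side as an operator on `ℓ^∞`. Uniformity in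
  -- `n` is essential, since site `n` is coupled to site `n + 1`.
  have key : ∀ k : ℕ, ∀ n, ∀ r ∈ Icc s t, |x n r - y n r| ≤ C * ((M * (r - s)) ^ k / k !) := by
    intro k
    induction k with
    | zero => simpa using hbase
    | succ k ih =>
      have hint : ∀ r ∈ Icc s t, ∀ D : ℝ → ℝ,
          (∀ u ∈ Icc s t, |D u| ≤ M * (C * ((M * (u - s)) ^ k / k !))) →
          |∫ u in s..r, D u| ≤ C * ((M * (r - s)) ^ (k + 1) / (k + 1) !) := by
        intro r hr D hD
        have h1 := intervalIntegral.norm_integral_le_of_norm_le (μ := volume) (f := D) hr.1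
          (g := fun u => M * (C * ((M * (u - s)) ^ k / k !)))
          (ae_of_all _ fun u hu => hD u ⟨hu.1.le, hu.2.trans hr.2⟩)
          (Continuous.intervalIntegrable (by fun_prop) _ _)
        refine h1.trans_eq ?_
        have hd : ∀ u ∈ uIcc s r, HasDerivAt
            (fun u => C * ((M * (u - s)) ^ (k + 1) / (k + 1) !))
            (M * (C * ((M * (u - s)) ^ k / k !))) u := by
          intro u _
          refine (((((hasDerivAt_id' u).sub_const s).const_mul M).fun_pow (k + 1)).div_const
            ((k + 1) ! : ℝ)).const_mul C |>.congr_deriv ?_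
          rw [Nat.factorial_succ, Nat.add_sub_cancel]
          push_cast
          have : (k + 1 : ℝ) ≠ 0 := by positivity
          field_simp
        rw [intervalIntegral.integral_eq_sub_of_hasDerivAt hd
          (Continuous.intervalIntegrable (by fun_prop) _ _)]
        simp
      intro n r hr
      rcases n with - | - | n
      · rw [hx.boundary r hr.1, hy.boundary r hr.1, sub_self, abs_zero]
        have := sub_nonneg.2 hr.1
        positivity
      · have e : x 1 r - y 1 r = ∫ u in s..r, (-(x 2 u - y 2 u) - ν * (x 1 u - y 1 u)) := by
          rw [hx.forced r hr.1, hy.forced r hr.1, add_sub_add_right_eq_sub, add_sub_add_left_eq_sub,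
            ← intervalIntegral.integral_sub
            (IntervalIntegrable.sub (f := fun u => -x 2 u) (hx.integrable 2 r hr.1).neg
              ((hx.integrable 1 r hr.1).const_mul ν))
            (IntervalIntegrable.sub (f := fun u => -y 2 u) (hy.integrable 2 r hr.1).neg
              ((hy.integrable 1 r hr.1).const_mul ν))]
          congr 1
          funext u
          ring
        rw [zero_add, e]
        refine hint r hr _ fun u hu => ?_
        have h1 := abs_le.1 (ih 1 u hu)
        have h2 := abs_le.1 (ih 2 u hu)
        simp only [M, abs_le] at h1 h2 ⊢
        constructor <;> nlinarith
      · have e : x (n + 2) r - y (n + 2) r = ∫ u in s..r, ((x (n + 1) u - y (n + 1) u) -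
            (x (n + 3) u - y (n + 3) u) - ν * (x (n + 2) u - y (n + 2) u)) := by
          have hx1 := hx.transport (n + 2) (by omega) r hr.1
          have hy1 := hy.transport (n + 2) (by omega) r hr.1
          simp only [show n + 2 - 1 = n + 1 by omega, show n + 2 + 1 = n + 3 by omega] at hx1 hy1
          rw [hx1, hy1, add_sub_add_left_eq_sub, ← intervalIntegral.integral_sub
            (((hx.integrable (n + 1) r hr.1).sub (hx.integrable (n + 3) r hr.1)).sub
              ((hx.integrable (n + 2) r hr.1).const_mul ν))
            (((hy.integrable (n + 1) r hr.1).sub (hy.integrable (n + 3) r hr.1)).sub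
              ((hy.integrable (n + 2) r hr.1).const_mul ν))]
          congr 1
          funext u
          ring
        rw [show n + 1 + 1 = n + 2 by omega, e]
        refine hint r hr _ fun u hu => ?_
        have h1 := abs_le.1 (ih (n + 1) u hu)
        have h2 := abs_le.1 (ih (n + 2) u hu)
        have h3 := abs_le.1 (ih (n + 3) u hu)
        simp only [M, abs_le] at h1 h2 h3 ⊢
        constructor <;> nlinarith
  have hlim : Tendsto (fun k : ℕ => C * ((M * (t - s)) ^ k / k !)) atTop (𝓝 (C * 0)) :=
    (FloorSemiring.tendsto_pow_div_factorial_atTop _).const_mul C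
  have h0 : |x n t - y n t| ≤ C * 0 := ge_of_tendsto' hlim fun k => key k n t ⟨ht, le_rfl⟩
  rw [mul_zero] at h0
  exact sub_eq_zero.1 (abs_nonpos_iff.1 h0)

/-- Differentiation under the convolution, in integrated form. -/
lemma integral_conv_deriv {f f' ℓ : ℝ → ℝ} (hf : ∀ r, HasDerivAt f (f' r) r) (hf' : Continuous f')
    {s t C : ℝ} (hst : s ≤ t) (hm : AEStronglyMeasurable ℓ (volume.restrict (Ioc s t)))
    (hC : ∀ u ∈ Icc s t, |ℓ u| ≤ C) :
    IntervalIntegrable (fun v => f 0 * ℓ v + ∫ u in s..v, f' (v - u) * ℓ u) volume s t ∧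
      ∫ v in s..t, (f 0 * ℓ v + ∫ u in s..v, f' (v - u) * ℓ u) =
        ∫ u in s..t, f (t - u) * ℓ u := by
  set μ := (volume : Measure ℝ).restrict (Ioc s t) with hμ
  have hCn : 0 ≤ C := (abs_nonneg _).trans (hC s ⟨le_rfl, hst⟩)
  obtain ⟨D, hD⟩ := (isCompact_Icc (a := s - t) (b := t - s)).exists_bound_of_continuousOn
    hf'.continuousOn
  have hℓint : Integrable ℓ μ := by
    refine Integrable.mono' (integrable_const C) hm ?_
    filter_upwards [ae_restrict_mem measurableSet_Ioc] with u hu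
    exact hC u ⟨hu.1.le, hu.2⟩
  -- Fubini on the triangle `u < v`: integrating `f'(v - u)` over `v` first gives `f(t - u) - f 0`,
  -- and the boundary term supplies the missing `f 0`.
  set S : Set (ℝ × ℝ) := {p | p.2 < p.1}
  have hS : MeasurableSet S := measurableSet_lt measurable_snd measurable_fst
  set F : ℝ → ℝ → ℝ := fun v u => S.indicator (fun p => f' (p.1 - p.2) * ℓ p.2) (v, u)
  have hF : Integrable (Function.uncurry F) (μ.prod μ) := by
    have e : Function.uncurry F = S.indicator (fun p => f' (p.1 - p.2) * ℓ p.2) := rfl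
    rw [e]
    refine Integrable.indicator ?_ hS
    refine Integrable.mono' (integrable_const (D * C)) ?_ ?_
    · exact (hf'.comp (continuous_fst.sub continuous_snd)).aestronglyMeasurable.mul hm.comp_snd
    · rw [hμ, Measure.prod_restrict]
      filter_upwards [ae_restrict_mem (measurableSet_Ioc.prod measurableSet_Ioc)] with p hp
      obtain ⟨⟨h1, h2⟩, h3, h4⟩ := hp
      rw [norm_mul]
      have hd := hD (p.1 - p.2) ⟨by linarith, by linarith⟩
      exact mul_le_mul hd (hC p.2 ⟨h3.le, h4⟩) (norm_nonneg _) ((norm_nonneg _).trans hd)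
  have hinner : ∀ v ∈ Ioc s t, ∫ u, F v u ∂μ = ∫ u in s..v, f' (v - u) * ℓ u := by
    intro v hv
    have e : F v = (Iio v).indicator (fun u => f' (v - u) * ℓ u) := by
      funext u
      simp only [F, S, indicator, mem_ofPred_eq, mem_Iio]
    rw [e, integral_indicator measurableSet_Iio, hμ, Measure.restrict_restrict measurableSet_Iio,
      intervalIntegral.integral_of_le hv.1.le, integral_Ioc_eq_integral_Ioo]
    congr 2
    ext u
    simp only [mem_inter_iff, mem_Iio, mem_Ioc, mem_Ioo]
    constructor
    · rintro ⟨h1, h2, -⟩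
      exact ⟨h2, h1⟩
    · rintro ⟨h1, h2⟩
      exact ⟨h2, h1, h2.le.trans hv.2⟩
  have houter : ∀ u ∈ Ioc s t, ∫ v, F v u ∂μ = (f (t - u) - f 0) * ℓ u := by
    intro u hu
    have e : (fun v => F v u) = (Ioi u).indicator (fun v => f' (v - u) * ℓ u) := by
      funext v
      simp only [F, S, indicator, mem_ofPred_eq, mem_Ioi]
    have e2 : Ioi u ∩ Ioc s t = Ioc u t := by
      ext v
      simp only [mem_inter_iff, mem_Ioi, mem_Ioc]
      constructor
      · rintro ⟨h1, -, h2⟩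
        exact ⟨h1, h2⟩
      · rintro ⟨h1, h2⟩
        exact ⟨h1, hu.1.trans h1, h2⟩
    rw [e, integral_indicator measurableSet_Ioi, hμ, Measure.restrict_restrict measurableSet_Ioi,
      e2, ← intervalIntegral.integral_of_le hu.2, intervalIntegral.integral_mul_const,
      intervalIntegral.integral_comp_sub_right f' u, sub_self,
      intervalIntegral.integral_eq_sub_of_hasDerivAt (fun x _ => hf x)
        (hf'.intervalIntegrable _ _)]
  have hI : Integrable (fun v => ∫ u in s..v, f' (v - u) * ℓ u) μ := by
    refine hF.integral_prod_left.congr ?_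
    filter_upwards [ae_restrict_mem measurableSet_Ioc] with v hv
    exact hinner v hv
  have hcont : Continuous f := continuous_iff_continuousAt.2 fun r => (hf r).continuousAt
  have hO : Integrable (fun u => (f (t - u) - f 0) * ℓ u) μ := by
    refine hF.integral_prod_right.congr ?_
    filter_upwards [ae_restrict_mem measurableSet_Ioc] with u hu
    exact houter u hu
  refine ⟨(intervalIntegrable_iff_integrableOn_Ioc_of_le hst).2
    ((hℓint.const_mul (f 0)).add hI), ?_⟩
  rw [intervalIntegral.integral_of_le hst, intervalIntegral.integral_of_le hst,
    integral_add (hℓint.const_mul (f 0)) hI]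
  have h1 : ∫ v in Ioc s t, ∫ u in s..v, f' (v - u) * ℓ u =
      ∫ u in Ioc s t, (f (t - u) - f 0) * ℓ u := by
    rw [← setIntegral_congr_fun measurableSet_Ioc hinner,
      ← setIntegral_congr_fun measurableSet_Ioc houter]
    exact integral_integral_swap hF
  rw [h1, ← integral_add (hℓint.const_mul (f 0)) hO]
  refine integral_congr_ae (ae_of_all _ fun u => ?_)
  ring

/-- The solution of the transport equation with zero initial values and forcing path `ℓ`. -/
noncomputable def transportPath (ν s : ℝ) (ℓ : ℝ → ℝ) (n : ℕ) (t : ℝ) : ℝ :=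
  transportKernel ν n 0 * ℓ t + ∫ u in s..t, transportKernelDeriv ν n (t - u) * ℓ u

/-- Time integrals of the path are convolutions of `ℓ` with `k_n` instead of `k_n'`. Each equation
thus reduces to the differential system of the kernel under a single integral, and `k_1(0) = 1`
produces the forcing. -/
lemma isTransportPath_transportPath {ν s : ℝ} {ℓ : ℝ → ℝ} (hν : 0 ≤ ν)
    (hm : ∀ t, AEStronglyMeasurable ℓ (volume.restrict (Ioc s t)))
    (hb : ∀ T, ∃ C, ∀ u ∈ Icc s T, |ℓ u| ≤ C) :
    IsTransportPath ν s ℓ (fun _ => 0) (transportPath ν s ℓ) := by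
  have key : ∀ n t, s ≤ t → IntervalIntegrable (transportPath ν s ℓ n) volume s t ∧
      ∫ v in s..t, transportPath ν s ℓ n v = ∫ u in s..t, transportKernel ν n (t - u) * ℓ u := by
    intro n t ht
    obtain ⟨C, hC⟩ := hb t
    exact integral_conv_deriv (hasDerivAt_transportKernel ν n)
      (continuous_transportKernelDeriv ν n) ht (hm t) hC
  have hi : ∀ n t, s ≤ t →
      IntervalIntegrable (fun u => transportKernel ν n (t - u) * ℓ u) volume s t := by
    intro n t ht
    obtain ⟨C, hC⟩ := hb t
    have hℓ : IntervalIntegrable ℓ volume s t := by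
      rw [intervalIntegrable_iff_integrableOn_Ioc_of_le ht]
      refine Integrable.mono' (integrable_const C) (hm t) ?_
      filter_upwards [ae_restrict_mem measurableSet_Ioc] with u hu
      exact hC u ⟨hu.1.le, hu.2⟩
    exact hℓ.continuousOn_mul
      ((continuous_transportKernel ν n).comp (continuous_const.sub continuous_id)).continuousOn
  refine ⟨fun T hT => ?_, fun n t ht => (key n t ht).1, fun t ht => ?_, fun t ht => ?_,
    fun n hn t ht => ?_⟩
  · obtain ⟨C, hC⟩ := hb T
    have hC0 : 0 ≤ C := (abs_nonneg _).trans (hC s ⟨le_rfl, hT⟩)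
    set B := (2 + ν) * Real.exp ((T - s) + (T - s) ^ 2)
    refine ⟨C + B * C * (T - s), fun n t ht => ?_⟩
    have h1 : |transportKernel ν n 0 * ℓ t| ≤ C := by
      rw [transportKernel_zero_right]
      split_ifs
      · simpa using hC t ht
      · simpa using hC0
    have h2 : |∫ u in s..t, transportKernelDeriv ν n (t - u) * ℓ u| ≤ B * C * (T - s) := by
      refine (intervalIntegral.norm_integral_le_of_norm_le_const (C := B * C)
        (f := fun u => transportKernelDeriv ν n (t - u) * ℓ u) fun u hu => ?_).trans ?_
      · rw [uIoc_of_le ht.1] at hu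
        have h3 : 0 ≤ t - u := sub_nonneg.2 hu.2
        have h4 : t - u ≤ T - s := by linarith [hu.1, ht.2]
        rw [norm_mul]
        refine mul_le_mul ((abs_transportKernelDeriv_le hν h3 n).trans ?_)
          (hC u ⟨hu.1.le, hu.2.trans ht.2⟩) (norm_nonneg _) (by positivity)
        simp only [B]
        gcongr
      · rw [abs_of_nonneg (sub_nonneg.2 ht.1)]
        have : t - s ≤ T - s := by linarith [ht.2]
        gcongr
    exact (abs_add_le _ _).trans (add_le_add h1 h2)
  · simp [transportPath, transportKernel_zero_left, transportKernelDeriv]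
  · rw [zero_add, intervalIntegral.integral_sub (f := fun u => -transportPath ν s ℓ 2 u)
        (key 2 t ht).1.neg ((key 1 t ht).1.const_mul ν),
      intervalIntegral.integral_neg, intervalIntegral.integral_const_mul, (key 2 t ht).2,
      (key 1 t ht).2, ← intervalIntegral.integral_neg, ← intervalIntegral.integral_const_mul,
      ← intervalIntegral.integral_sub (f := fun u => -(transportKernel ν 2 (t - u) * ℓ u))
        (hi 2 t ht).neg ((hi 1 t ht).const_mul ν), transportPath,
      transportKernel_zero_right, if_pos rfl, one_mul, add_comm]
    congr 1
    refine intervalIntegral.integral_congr fun u _ => ?_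
    simp only [transportKernelDeriv]
    ring
  · obtain ⟨n, rfl⟩ : ∃ m, n = m + 2 := ⟨n - 2, by omega⟩
    simp only [show n + 2 - 1 = n + 1 by omega, show n + 2 + 1 = n + 3 by omega]
    rw [intervalIntegral.integral_sub ((key (n + 1) t ht).1.sub (key (n + 3) t ht).1)
        ((key (n + 2) t ht).1.const_mul ν),
      intervalIntegral.integral_sub (key (n + 1) t ht).1 (key (n + 3) t ht).1,
      intervalIntegral.integral_const_mul, (key (n + 1) t ht).2, (key (n + 2) t ht).2,
      (key (n + 3) t ht).2, ← intervalIntegral.integral_const_mul,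
      ← intervalIntegral.integral_sub (hi (n + 1) t ht) (hi (n + 3) t ht),
      ← intervalIntegral.integral_sub ((hi (n + 1) t ht).sub (hi (n + 3) t ht))
        ((hi (n + 2) t ht).const_mul ν), transportPath,
      transportKernel_zero_right, if_neg (by omega), zero_add, zero_mul, zero_add]
    refine intervalIntegral.integral_congr fun u _ => ?_
    simp only [transportKernelDeriv]
    ring

/-! ### Càdlàg paths and Riemann-Stieltjes sums. -/

/-- The path `ℓ` is right-continuous with left limits on `[s, ∞)`. -/
def IsCadlagFrom (s : ℝ) (ℓ : ℝ → ℝ) : Prop :=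
  ∀ t, s ≤ t → ContinuousWithinAt ℓ (Ici t) t ∧ ∃ l, Tendsto ℓ (𝓝[Ico s t] t) (𝓝 l)

lemma IsCadlagFrom.exists_bound {s : ℝ} {ℓ : ℝ → ℝ} (h : IsCadlagFrom s ℓ) (T : ℝ) :
    ∃ C, ∀ u ∈ Icc s T, |ℓ u| ≤ C := by
  refine isCompact_Icc.induction_on (p := fun S => ∃ C, ∀ u ∈ S, |ℓ u| ≤ C) ⟨0, by simp⟩
    (fun S S' hS ⟨C, hC⟩ => ⟨C, fun u hu => hC u (hS hu)⟩)
    (fun S S' ⟨C, hC⟩ ⟨C', hC'⟩ => ⟨max C C', ?_⟩) (fun t ht => ?_)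
  · rintro u (hu | hu)
    · exact (hC u hu).trans (le_max_left _ _)
    · exact (hC' u hu).trans (le_max_right _ _)
  · obtain ⟨h1, l, h2⟩ := h t ht.1
    have e1 : ∀ᶠ u in 𝓝[Ici t] t, |ℓ u| ≤ max (|ℓ t| + 1) (|l| + 1) := by
      filter_upwards [h1.abs.eventually_lt_const (lt_add_one _)] with u hu
      exact hu.le.trans (le_max_left _ _)
    have e2 : ∀ᶠ u in 𝓝[Ico s t] t, |ℓ u| ≤ max (|ℓ t| + 1) (|l| + 1) := by
      filter_upwards [h2.abs.eventually_lt_const (lt_add_one _)] with u hu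
      exact hu.le.trans (le_max_right _ _)
    have e3 : ∀ᶠ u in 𝓝[Icc s T] t, |ℓ u| ≤ max (|ℓ t| + 1) (|l| + 1) := by
      have e4 := Filter.eventually_sup.2 ⟨e1, e2⟩
      rw [← nhdsWithin_union] at e4
      refine e4.filter_mono (nhdsWithin_mono t fun u hu => ?_)
      rcases le_or_gt t u with h | h
      · exact Or.inl h
      · exact Or.inr ⟨hu.1, h⟩
    exact ⟨_, e3, _, fun u hu => hu⟩

/-- The left end point of the interval of the partition of mesh `δ` from `s` that contains `u`. -/
noncomputable def gridPoint (s δ u : ℝ) : ℝ := s + δ * ⌊(u - s) / δ⌋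

lemma gridPoint_le {s δ : ℝ} (hδ : 0 < δ) (u : ℝ) : gridPoint s δ u ≤ u := by
  have := (le_div_iff₀ hδ).1 (Int.floor_le ((u - s) / δ))
  unfold gridPoint
  linarith

lemma lt_gridPoint_add {s δ : ℝ} (hδ : 0 < δ) (u : ℝ) : u < gridPoint s δ u + δ := by
  have := (div_lt_iff₀ hδ).1 (Int.lt_floor_add_one ((u - s) / δ))
  unfold gridPoint
  linarith

lemma measurable_comp_gridPoint (s δ : ℝ) (θ : ℝ → ℝ) : Measurable fun u => θ (gridPoint s δ u) :=
  (measurable_from_top (f := fun k : ℤ => θ (s + δ * k))).comp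
    (Int.measurable_floor.comp ((measurable_id.sub_const s).div_const δ))

lemma tendsto_gridPoint_add {ι : Type*} {l : Filter ι} {s : ℝ} {δ : ι → ℝ} (hδ : ∀ i, 0 < δ i)
    (h0 : Tendsto δ l (𝓝 0)) (u : ℝ) :
    Tendsto (fun i => gridPoint s (δ i) u + δ i) l (𝓝[Ici u] u) := by
  refine tendsto_nhdsWithin_iff.2 ⟨?_, Eventually.of_forall fun i => (lt_gridPoint_add (hδ i) u).le⟩
  refine tendsto_of_tendsto_of_tendsto_of_le_of_le tendsto_const_nhds
    (h := fun i => u + δ i) (by simpa using h0.const_add u)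
    (fun i => (lt_gridPoint_add (hδ i) u).le) (fun i => ?_)
  have := gridPoint_le (s := s) (hδ i) u
  simp only
  linarith

lemma tendsto_gridPoint {ι : Type*} {l : Filter ι} {s : ℝ} {δ : ι → ℝ} (hδ : ∀ i, 0 < δ i)
    (h0 : Tendsto δ l (𝓝 0)) (u : ℝ) : Tendsto (fun i => gridPoint s (δ i) u) l (𝓝 u) := by
  have := ((tendsto_gridPoint_add (s := s) hδ h0 u).mono_right nhdsWithin_le_nhds).sub h0
  simpa using this

/-- Step functions that read `ℓ` at the right end of each cell converge pointwise, by
right-continuity. -/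
lemma IsCadlagFrom.aestronglyMeasurable {s : ℝ} {ℓ : ℝ → ℝ} (h : IsCadlagFrom s ℓ) (t : ℝ) :
    AEStronglyMeasurable ℓ (volume.restrict (Ioc s t)) := by
  have hδ : ∀ N : ℕ, (0 : ℝ) < 1 / ((N : ℝ) + 1) := fun N => by positivity
  refine aestronglyMeasurable_of_tendsto_ae atTop
    (f := fun (N : ℕ) u => ℓ (gridPoint s (1 / ((N : ℝ) + 1)) u + 1 / ((N : ℝ) + 1)))
    (fun N => (measurable_comp_gridPoint s _ fun x => ℓ (x + 1 / ((N : ℝ) + 1))).aestronglyMeasurable)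
    ?_
  filter_upwards [ae_restrict_mem measurableSet_Ioc] with u hu
  exact (h u hu.1.le).1.tendsto.comp
    (tendsto_gridPoint_add hδ tendsto_one_div_add_atTop_nhds_zero_nat u)

lemma gridPoint_eq {s δ : ℝ} (hδ : 0 < δ) (i : ℕ) {u : ℝ}
    (hu : u ∈ Ioo (s + δ * i) (s + δ * ((i + 1 : ℕ) : ℝ))) : gridPoint s δ u = s + δ * i := by
  have : ⌊(u - s) / δ⌋ = (i : ℤ) := by
    rw [Int.floor_eq_iff, le_div_iff₀ hδ, div_lt_iff₀ hδ]
    obtain ⟨h1, h2⟩ := hu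
    push_cast at h2 ⊢
    constructor <;> nlinarith
  rw [gridPoint, this, Int.cast_natCast]

lemma sum_integral_mul_gridPoint {s δ : ℝ} (hδ : 0 < δ) (N : ℕ) {g : ℝ → ℝ} (hg : Continuous g)
    (θ : ℝ → ℝ) :
    ∑ i ∈ Finset.range N, (∫ u in (s + δ * i)..(s + δ * ((i + 1 : ℕ) : ℝ)), g u) * θ (s + δ * i) =
      ∫ u in s..(s + δ * N), g u * θ (gridPoint s δ u) := by
  have hle : ∀ i : ℕ, s + δ * i ≤ s + δ * ((i + 1 : ℕ) : ℝ) := by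
    intro i
    push_cast
    nlinarith
  have heq : ∀ i : ℕ, EqOn (fun u => g u * θ (s + δ * i)) (fun u => g u * θ (gridPoint s δ u))
      (Ioo (s + δ * i) (s + δ * ((i + 1 : ℕ) : ℝ))) := by
    intro i u hu
    simp only [gridPoint_eq hδ i hu]
  have := intervalIntegral.sum_integral_adjacent_intervals (μ := volume)
    (f := fun u => g u * θ (gridPoint s δ u)) (a := fun i : ℕ => s + δ * i) (n := N)
    (fun i _ => by
      have hc : IntervalIntegrable (fun u => g u * θ (s + δ * i)) volume (s + δ * i)
        (s + δ * ((i + 1 : ℕ) : ℝ)) := (hg.mul continuous_const).intervalIntegrable _ _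
      exact hc.congr_uIoo (by rw [uIoo_of_le (hle i)]; exact heq i))
  simp only [Nat.cast_zero, mul_zero, add_zero] at this
  rw [← this]
  refine Finset.sum_congr rfl fun i _ => ?_
  rw [← intervalIntegral.integral_mul_const]
  exact intervalIntegral.integral_congr_Ioo_of_le (hle i) (heq i)

/-- The Riemann-Stieltjes sum of `f (t - ·)` against `ℓ` for the partition of `[s, s + δ N]` of
mesh `δ`. -/
noncomputable def stieltjesSum (f ℓ : ℝ → ℝ) (s t δ : ℝ) (N : ℕ) : ℝ :=
  ∑ i ∈ Finset.range N, f (t - (s + δ * i)) * (ℓ (s + δ * ((i + 1 : ℕ) : ℝ)) - ℓ (s + δ * i))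

/-- Summation by parts; increments of `f` become integrals of `f'`. The values of `ℓ` that remain
sit at right end points, so right-continuity suffices for the limit. -/
lemma stieltjesSum_eq {f f' ℓ : ℝ → ℝ} (hf : ∀ r, HasDerivAt f (f' r) r) (hf' : Continuous f')
    {s δ : ℝ} (t : ℝ) (hδ : 0 < δ) (N : ℕ) :
    stieltjesSum f ℓ s t δ N = f (t - (s + δ * N)) * ℓ (s + δ * N) - f (t - s) * ℓ s +
      ∫ u in s..(s + δ * N), f' (t - u) * ℓ (gridPoint s δ u + δ) := by
  have h1 := sum_integral_mul_gridPoint (s := s) hδ N (g := fun u => f' (t - u))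
    (hf'.comp (continuous_const.sub continuous_id)) fun x => ℓ (x + δ)
  rw [← h1, stieltjesSum]
  clear h1
  induction N with
  | zero => simp
  | succ N ih =>
    rw [Finset.sum_range_succ, Finset.sum_range_succ, ih,
      intervalIntegral.integral_comp_sub_left (fun x => f' x) t,
      intervalIntegral.integral_eq_sub_of_hasDerivAt (fun x _ => hf x)
        (hf'.intervalIntegrable _ _),
      show s + δ * (N : ℝ) + δ = s + δ * ((N + 1 : ℕ) : ℝ) by push_cast; ring]
    ring

lemma tendsto_integral_gridPoint {s t C : ℝ} (hst : s < t) {g θ : ℝ → ℝ} (hg : Continuous g)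
    {p : ℝ → ℝ → ℝ} (hp : ∀ δ, Measurable fun u => p δ u)
    (hb : ∀ δ ∈ Ioc 0 (t - s), ∀ u ∈ Icc s t, |p δ u| ≤ C)
    (hlim : ∀ u ∈ Icc s t,
      Tendsto (fun N : ℕ => p ((t - s) / ((N : ℝ) + 1)) u) atTop (𝓝 (θ u))) :
    Tendsto (fun N : ℕ => ∫ u in s..t, g u * p ((t - s) / ((N : ℝ) + 1)) u) atTop
      (𝓝 (∫ u in s..t, g u * θ u)) := by
  have hst' := sub_pos.2 hst
  refine intervalIntegral.tendsto_integral_filter_of_dominated_convergence (fun u => |g u| * C)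
    (Eventually.of_forall fun N => (hg.measurable.mul (hp _)).aestronglyMeasurable)
    (Eventually.of_forall fun N => ae_of_all _ fun u hu => ?_)
    ((hg.abs.mul continuous_const).intervalIntegrable _ _) (ae_of_all _ fun u hu => ?_)
  · rw [uIoc_of_le hst.le] at hu
    rw [norm_mul]
    refine mul_le_mul_of_nonneg_left (hb _ ⟨by positivity, ?_⟩ u ⟨hu.1.le, hu.2⟩) (norm_nonneg _)
    exact div_le_self hst'.le (by linarith [(Nat.cast_nonneg N : (0 : ℝ) ≤ N)])
  · rw [uIoc_of_le hst.le] at hu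
    exact (hlim u ⟨hu.1.le, hu.2⟩).const_mul (g u)

lemma mesh_mul (s t : ℝ) (N : ℕ) : s + (t - s) / ((N : ℝ) + 1) * ((N + 1 : ℕ) : ℝ) = t := by
  push_cast
  have : (N + 1 : ℝ) ≠ 0 := by positivity
  field_simp
  ring

lemma tendsto_mesh (c : ℝ) : Tendsto (fun N : ℕ => c / ((N : ℝ) + 1)) atTop (𝓝 0) :=
  tendsto_const_nhds.div_atTop (tendsto_atTop_add_const_right _ _ tendsto_natCast_atTop_atTop)

/-- Riemann-Stieltjes sums converge to the transport path. -/
lemma tendsto_stieltjesSum {ν s t : ℝ} {ℓ : ℝ → ℝ} (hst : s < t) (h : IsCadlagFrom s ℓ)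
    (h0 : ℓ s = 0) (n : ℕ) :
    Tendsto (fun N : ℕ => stieltjesSum (transportKernel ν n) ℓ s t ((t - s) / ((N : ℝ) + 1)) (N + 1))
      atTop (𝓝 (transportPath ν s ℓ n t)) := by
  have hst' := sub_pos.2 hst
  have hδ : ∀ N : ℕ, 0 < (t - s) / ((N : ℝ) + 1) := fun N => by positivity
  -- The right end of the cell of `u` can lie beyond `t`, by at most one mesh.
  obtain ⟨C, hC⟩ := h.exists_bound (t + (t - s))
  have e : ∀ N : ℕ, stieltjesSum (transportKernel ν n) ℓ s t ((t - s) / ((N : ℝ) + 1)) (N + 1) =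
      transportKernel ν n 0 * ℓ t + ∫ u in s..t, transportKernelDeriv ν n (t - u) *
        ℓ (gridPoint s ((t - s) / ((N : ℝ) + 1)) u + (t - s) / ((N : ℝ) + 1)) := by
    intro N
    rw [stieltjesSum_eq (hasDerivAt_transportKernel ν n) (continuous_transportKernelDeriv ν n) t
      (hδ N), mesh_mul, h0, sub_self, mul_zero, sub_zero]
  simp_rw [e]
  refine Tendsto.const_add _ (tendsto_integral_gridPoint hst
    ((continuous_transportKernelDeriv ν n).comp (continuous_const.sub continuous_id))
    (p := fun δ u => ℓ (gridPoint s δ u + δ)) (C := C)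
    (fun δ => measurable_comp_gridPoint s δ fun x => ℓ (x + δ)) (fun δ hδ u hu => hC _ ?_)
    fun u hu => ?_)
  · have h1 := gridPoint_le (s := s) hδ.1 u
    have h2 := lt_gridPoint_add (s := s) hδ.1 u
    constructor <;> linarith [hu.1, hu.2, hδ.2]
  · exact (h u hu.1).1.tendsto.comp (tendsto_gridPoint_add hδ (tendsto_mesh _) u)

/-- Riemann sums of a continuous function converge to its integral. -/
lemma tendsto_riemannSum {s t : ℝ} (hst : s < t) {θ : ℝ → ℝ} (hθ : Continuous θ) :
    Tendsto (fun N : ℕ => ∑ i ∈ Finset.range (N + 1),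
        (t - s) / ((N : ℝ) + 1) * θ (s + (t - s) / ((N : ℝ) + 1) * i)) atTop
      (𝓝 (∫ u in s..t, θ u)) := by
  have hst' := sub_pos.2 hst
  have hδ : ∀ N : ℕ, 0 < (t - s) / ((N : ℝ) + 1) := fun N => by positivity
  obtain ⟨C, hC⟩ := (isCompact_Icc (a := s - (t - s)) (b := t)).exists_bound_of_continuousOn
    hθ.continuousOn
  have key := tendsto_integral_gridPoint hst (g := fun _ => 1) continuous_const (θ := θ)
    (p := fun δ u => θ (gridPoint s δ u)) (C := C)
    (fun δ => measurable_comp_gridPoint s δ θ) (fun δ hδ u hu => hC _ ?_)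
    fun u hu => (hθ.tendsto u).comp (tendsto_gridPoint hδ (tendsto_mesh _) u)
  · simp only [one_mul] at key
    refine key.congr fun N => ?_
    have := sum_integral_mul_gridPoint (s := s) (hδ N) (N + 1) (g := fun _ => 1) continuous_const θ
    rw [mesh_mul] at this
    simp only [one_mul] at this
    rw [← this]
    refine Finset.sum_congr rfl fun i _ => ?_
    simp only [intervalIntegral.integral_const, smul_eq_mul, mul_one]
    push_cast
    ring
  · have h1 := gridPoint_le (s := s) hδ.1 u
    have h2 := lt_gridPoint_add (s := s) hδ.1 u
    constructor <;> linarith [hu.1, hu.2, hδ.2]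

/-! ### Paths driven by a Lévy process and their characteristic functions. -/

section Driving

variable {Ω : Type*} [MeasurableSpace Ω] {P : Measure Ω} {s : ℝ} {ℓ : ℝ → Ω → ℝ}

lemma IsLevyProcess.measurable_shift (h : IsLevyProcess (fun u : ℝ≥0 => ℓ (s + (u : ℝ))) P) {t : ℝ}
    (ht : s ≤ t) : Measurable (ℓ t) := by
  have := h.measurable (Real.toNNReal (t - s))
  rwa [Real.coe_toNNReal _ (sub_nonneg.2 ht), add_sub_cancel] at this

lemma IsLevyProcess.start_shift (h : IsLevyProcess (fun u : ℝ≥0 => ℓ (s + (u : ℝ))) P) :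
    ∀ᵐ ω ∂P, ℓ s ω = 0 := by
  simpa using h.start

lemma IsLevyProcess.isCadlagFrom (h : IsLevyProcess (fun u : ℝ≥0 => ℓ (s + (u : ℝ))) P) :
    ∀ᵐ ω ∂P, IsCadlagFrom s (fun t => ℓ t ω) := by
  filter_upwards [h.cadlag] with ω hω t ht
  obtain ⟨h1, l, h2⟩ := hω (Real.toNNReal (t - s))
  have hcont : Continuous fun u : ℝ => Real.toNNReal (u - s) := by fun_prop
  have heq : ∀ u, s ≤ u → ℓ (s + ((Real.toNNReal (u - s) : ℝ≥0) : ℝ)) ω = ℓ u ω := by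
    intro u hu
    rw [Real.coe_toNNReal _ (sub_nonneg.2 hu), add_sub_cancel]
  refine ⟨?_, l, ?_⟩
  · have h3 : Tendsto (fun u : ℝ => Real.toNNReal (u - s)) (𝓝[Ici t] t)
        (𝓝[Ici (Real.toNNReal (t - s))] (Real.toNNReal (t - s))) :=
      hcont.continuousWithinAt.tendsto_nhdsWithin fun u hu =>
        Real.toNNReal_le_toNNReal (sub_le_sub_right hu s)
    have h4 := h1.tendsto.comp h3
    simp only [heq t ht] at h4
    refine h4.congr' ?_
    filter_upwards [self_mem_nhdsWithin] with u hu
    exact heq u (ht.trans hu)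
  · have h3 : Tendsto (fun u : ℝ => Real.toNNReal (u - s)) (𝓝[Ico s t] t)
        (𝓝[<] (Real.toNNReal (t - s))) :=
      hcont.continuousWithinAt.tendsto_nhdsWithin fun u hu =>
        (Real.toNNReal_lt_toNNReal_iff_of_nonneg (sub_nonneg.2 hu.1)).2
          (sub_lt_sub_right hu.2 s)
    refine (h2.comp h3).congr' ?_
    filter_upwards [self_mem_nhdsWithin] with u hu
    exact heq u hu.1

lemma IsLevyProcess.charFun_increment {Ψ : ℝ → ℂ}
    (h : IsLevyProcess (fun u : ℝ≥0 => ℓ (s + (u : ℝ))) P)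
    (hΨ : HasCumulant (fun u : ℝ≥0 => ℓ (s + (u : ℝ))) Ψ P) (a b : ℝ≥0) (z : ℝ) :
    charFun (P.map fun ω => ℓ (s + ((a + b : ℝ≥0) : ℝ)) ω - ℓ (s + (a : ℝ)) ω) z =
      Complex.exp (((b : ℝ) : ℂ) * Ψ z) := by
  rw [(h.stationary_increments a b).map_eq]
  exact hΨ b z

lemma IsLevyProcess.measurable_stieltjesSum
    (h : IsLevyProcess (fun u : ℝ≥0 => ℓ (s + (u : ℝ))) P) (f : ℝ → ℝ) (t : ℝ) {δ : ℝ}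
    (hδ : 0 ≤ δ) (N : ℕ) : Measurable fun ω => stieltjesSum f (fun t => ℓ t ω) s t δ N := by
  unfold stieltjesSum
  refine Finset.measurable_fun_sum _ fun i _ => ((h.measurable_shift ?_).sub
    (h.measurable_shift ?_)).const_mul _
  · exact le_add_of_nonneg_right (by positivity)
  · exact le_add_of_nonneg_right (by positivity)

/-- The characteristic function of a Riemann-Stieltjes sum against a Lévy process. -/
lemma IsLevyProcess.charFun_stieltjesSum [IsProbabilityMeasure P] {Ψ : ℝ → ℂ}
    (h : IsLevyProcess (fun u : ℝ≥0 => ℓ (s + (u : ℝ))) P)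
    (hΨ : HasCumulant (fun u : ℝ≥0 => ℓ (s + (u : ℝ))) Ψ P) (f : ℝ → ℝ) (t : ℝ) {δ : ℝ}
    (hδ : 0 ≤ δ) (N : ℕ) (z : ℝ) :
    charFun (P.map fun ω => stieltjesSum f (fun t => ℓ t ω) s t δ N) z =
      Complex.exp (∑ i ∈ Finset.range N, (δ : ℂ) * Ψ (f (t - (s + δ * i)) * z)) := by
  lift δ to ℝ≥0 using hδ
  set τ : Fin (N + 1) → ℝ≥0 := fun i => δ * ((i : ℕ) : ℝ≥0) with hτ
  have hmono : Monotone τ := by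
    intro i j hij
    have : ((i : ℕ) : ℝ≥0) ≤ ((j : ℕ) : ℝ≥0) := by exact_mod_cast hij
    exact mul_le_mul_of_nonneg_left this (zero_le)
  set Y : Fin N → Ω → ℝ := fun i ω =>
    f (t - (s + δ * (i : ℕ))) * (ℓ (s + (τ i.succ : ℝ)) ω - ℓ (s + (τ i.castSucc : ℝ)) ω) with hY
  have hind : iIndepFun Y P :=
    (h.indep_increments N τ hmono).comp (fun i x => f (t - (s + δ * (i : ℕ))) * x)
      fun i => measurable_const_mul _
  have hmeas : ∀ i, Measurable (Y i) := fun i =>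
    ((h.measurable (τ i.succ)).sub (h.measurable (τ i.castSucc))).const_mul _
  have hsum : (fun ω => stieltjesSum f (fun t => ℓ t ω) s t δ N) = fun ω => ∑ i, Y i ω := by
    funext ω
    rw [stieltjesSum, Finset.sum_range]
    simp [hY, hτ]
  rw [hsum, hind.charFun_map_fun_sum_eq_prod fun i => (hmeas i).aemeasurable, Finset.prod_apply,
    Complex.exp_sum, Finset.prod_range]
  refine Finset.prod_congr rfl fun i _ => ?_
  have hsucc : τ i.succ = τ i.castSucc + δ := by
    simp only [hτ, Fin.val_succ, Fin.val_castSucc]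
    push_cast
    ring
  simp only [hY, hsucc]
  rw [← h.charFun_increment hΨ (τ i.castSucc) δ]
  exact charFun_map_mul_comp ((h.measurable (τ i.castSucc + δ)).sub
    (h.measurable (τ i.castSucc))).aemeasurable _ _

/-- The transport path driven by a Lévy process is measurable in the random parameter. -/
lemma IsLevyProcess.aemeasurable_transportPath
    (h : IsLevyProcess (fun u : ℝ≥0 => ℓ (s + (u : ℝ))) P) (ν : ℝ) (n : ℕ) {t : ℝ} (ht : s ≤ t) :
    AEMeasurable (fun ω => transportPath ν s (fun t => ℓ t ω) n t) P := by
  rcases ht.eq_or_lt with rfl | ht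
  · simp only [transportPath, intervalIntegral.integral_same, add_zero]
    exact ((h.measurable_shift le_rfl).const_mul _).aemeasurable
  · refine aemeasurable_of_tendsto_metrizable_ae atTop (f := fun (N : ℕ) ω =>
      stieltjesSum (transportKernel ν n) (fun t => ℓ t ω) s t ((t - s) / ((N : ℝ) + 1)) (N + 1))
      (fun N => Measurable.aemeasurable ?_) ?_
    · exact h.measurable_stieltjesSum _ _ (div_nonneg (sub_nonneg.2 ht.le) (by positivity)) _
    · filter_upwards [h.isCadlagFrom, h.start_shift] with ω h1 h2
      exact tendsto_stieltjesSum ht h1 h2 n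

lemma tendsto_charFun_of_tendstoInDistribution [IsProbabilityMeasure P] {ι : Type*} {l : Filter ι}
    {X : ι → Ω → ℝ} {Ω' : Type*} [MeasurableSpace Ω'] {P' : Measure Ω'} [IsProbabilityMeasure P']
    {Z : Ω' → ℝ} (h : TendstoInDistribution X l Z (fun _ => P) P') (z : ℝ) :
    Tendsto (fun i => charFun (P.map (X i)) z) l (𝓝 (charFun (P'.map Z) z)) := by
  simp_rw [charFun_eq_integral_innerProbChar]
  exact (ProbabilityMeasure.tendsto_iff_forall_integral_rclike_tendsto ℂ).1 h.tendsto
    (BoundedContinuousFunction.innerProbChar z)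

/-- The characteristic function of the transport path driven by a stable Lévy process. -/
lemma IsLevyProcess.charFun_transportPath [IsProbabilityMeasure P] {α σ : ℝ} (hα : 0 < α)
    (h : IsLevyProcess (fun u : ℝ≥0 => ℓ (s + (u : ℝ))) P)
    (hΨ : HasCumulant (fun u : ℝ≥0 => ℓ (s + (u : ℝ)))
      (fun z : ℝ => ((-(σ ^ α * |z| ^ α) : ℝ) : ℂ)) P) (ν : ℝ) (n : ℕ) {t : ℝ} (ht : s < t)
    (z : ℝ) :
    charFun (P.map fun ω => transportPath ν s (fun t => ℓ t ω) n t) z =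
      ((Real.exp (-(|z| ^ α * σ ^ α * ∫ r in 0..(t - s), |transportKernel ν n r| ^ α)) : ℝ) : ℂ) := by
  have hδ : ∀ N : ℕ, 0 ≤ (t - s) / ((N : ℝ) + 1) :=
    fun N => div_nonneg (sub_nonneg.2 ht.le) (by positivity)
  have hconv : TendstoInDistribution (fun (N : ℕ) ω =>
      stieltjesSum (transportKernel ν n) (fun t => ℓ t ω) s t ((t - s) / ((N : ℝ) + 1)) (N + 1))
      atTop (fun ω => transportPath ν s (fun t => ℓ t ω) n t) (fun _ => P) P := by
    refine tendstoInDistribution_of_ae_tendsto (fun N => Measurable.aemeasurable ?_)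
      (h.aemeasurable_transportPath ν n ht.le) ?_
    · exact h.measurable_stieltjesSum _ _ (hδ N) _
    · filter_upwards [h.isCadlagFrom, h.start_shift] with ω h1 h2
      exact tendsto_stieltjesSum ht h1 h2 n
  refine tendsto_nhds_unique (tendsto_charFun_of_tendstoInDistribution hconv z) ?_
  have hcont : Continuous fun u => |transportKernel ν n (t - u)| ^ α :=
    (((continuous_transportKernel ν n).comp (continuous_const.sub continuous_id)).abs).rpow_const
      fun _ => Or.inr hα.le
  -- By homogeneity of `Ψ`, the exponents for the Stieltjes sums are Riemann sums of this integral.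
  have hlim := tendsto_riemannSum ht hcont
  rw [intervalIntegral.integral_comp_sub_left (fun r => |transportKernel ν n r| ^ α), sub_self]
    at hlim
  have hlim2 := ((Complex.continuous_ofReal.comp Real.continuous_exp).tendsto _).comp
    ((hlim.const_mul (|z| ^ α * σ ^ α)).neg)
  refine hlim2.congr fun N => ?_
  rw [h.charFun_stieltjesSum hΨ _ _ (hδ N)]
  simp only [Function.comp_def, Complex.ofReal_exp]
  rw [Finset.mul_sum, ← Finset.sum_neg_distrib, Complex.ofReal_sum]
  congr 1
  refine Finset.sum_congr rfl fun i _ => ?_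
  rw [abs_mul, Real.mul_rpow (abs_nonneg _) (abs_nonneg _)]
  push_cast
  ring

end Driving

/-! ### Pull-back laws through characteristic functions. -/

section Limit

variable {Ω : Type*} [MeasurableSpace Ω] {P : Measure Ω} [IsProbabilityMeasure P]

lemma IsPullbackLaw.tendsto_charFun {X : ℝ → Ω → ℝ} {μ : ProbabilityMeasure ℝ}
    (h : IsPullbackLaw P X μ) (z : ℝ) :
    Tendsto (fun s => charFun (P.map (X s)) z) atBot (𝓝 (charFun (μ : Measure ℝ) z)) := by
  have := tendsto_charFun_of_tendstoInDistribution h z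
  rwa [Measure.map_id] at this

/-- Lévy's continuity theorem is applied along sequences, which suffice because `atBot` on `ℝ` is
countably generated. -/
lemma isPullbackLaw_of_tendsto_charFun {X : ℝ → Ω → ℝ} {μ : ProbabilityMeasure ℝ}
    (hX : ∀ s, AEMeasurable (X s) P)
    (h : ∀ z, Tendsto (fun s => charFun (P.map (X s)) z) atBot (𝓝 (charFun (μ : Measure ℝ) z))) :
    IsPullbackLaw P X μ := by
  refine ⟨hX, aemeasurable_id, ?_⟩
  refine tendsto_of_seq_tendsto fun u hu => ?_
  refine ProbabilityMeasure.tendsto_of_tendsto_charFun fun z => ?_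
  simp only [ProbabilityMeasure.coe_mk, Measure.map_id]
  exact (h z).comp hu

/-- A law with characteristic function `exp (-c |z| ^ α)` is stable. -/
lemma isStableLaw_of_charFun {α c : ℝ} (hα : 0 < α) (hc : 0 < c) {μ : Measure ℝ}
    [IsProbabilityMeasure μ]
    (h : ∀ z, charFun μ z = ((Real.exp (-(|z| ^ α * c)) : ℝ) : ℂ)) : IsStableLaw α μ := by
  refine ⟨fun x hx => ?_, fun A B hA hB => ⟨0, ?_⟩⟩
  · have h1 := h 1
    rw [hx, charFun_dirac] at h1
    have h2 := congrArg norm h1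
    rw [Complex.norm_exp_ofReal_mul_I, Complex.norm_real, Real.norm_eq_abs, Real.abs_exp, abs_one,
      Real.one_rpow, one_mul] at h2
    have h3 : Real.exp (-c) < 1 := Real.exp_lt_one_iff.2 (by linarith)
    linarith
  · have hA' := Measure.isProbabilityMeasure_map (μ := μ) (f := fun x => A * x)
      (measurable_const_mul A).aemeasurable
    have hB' := Measure.isProbabilityMeasure_map (μ := μ) (f := fun x => B * x)
      (measurable_const_mul B).aemeasurable
    simp only [add_zero]
    have hC' := Measure.isProbabilityMeasure_map (μ := μ)
      (f := fun x => (A ^ α + B ^ α) ^ (1 / α) * x) (measurable_const_mul _).aemeasurable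
    refine Measure.ext_of_charFun (funext fun z => ?_)
    have hAα : 0 < A ^ α := Real.rpow_pos_of_pos hA α
    have hBα : 0 < B ^ α := Real.rpow_pos_of_pos hB α
    have hpow : ((A ^ α + B ^ α) ^ (1 / α)) ^ α = A ^ α + B ^ α := by
      rw [← Real.rpow_mul (by positivity), one_div, inv_mul_cancel₀ hα.ne', Real.rpow_one]
    rw [charFun_conv, charFun_map_mul, charFun_map_mul, charFun_map_mul, h, h, h,
      ← Complex.ofReal_mul, ← Real.exp_add, abs_mul, abs_mul, abs_mul, abs_of_pos hA, abs_of_pos hB,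
      abs_of_pos (Real.rpow_pos_of_pos (add_pos hAα hBα) _), Real.mul_rpow hA.le (abs_nonneg z),
      Real.mul_rpow hB.le (abs_nonneg z),
      Real.mul_rpow (Real.rpow_nonneg (add_pos hAα hBα).le _) (abs_nonneg z), hpow]
    congr 3
    ring

/-- If `exp (-|z| ^ α c ∫₀ᵀ g)` converges to a characteristic function as `T → ∞`, then `g ≥ 0` is
integrable. -/
lemma integrableOn_of_tendsto_charFun {α c t : ℝ} (hc : 0 < c) {g : ℝ → ℝ}
    (hg : Continuous g) (hg0 : ∀ r, 0 ≤ g r) {μ : Measure ℝ} [IsProbabilityMeasure μ]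
    (h : ∀ z : ℝ, Tendsto
      (fun s : ℝ => ((Real.exp (-(|z| ^ α * c * ∫ r in 0..(t - s), g r)) : ℝ) : ℂ)) atBot
      (𝓝 (charFun μ z))) : IntegrableOn g (Ioi 0) := by
  -- One `z ≠ 0` with modulus above `1/2` suffices: taking logarithms bounds all late integrals by
  -- `log 2 / (|z|^α c)`.
  have h0 : ∀ᶠ z in 𝓝[≠] (0 : ℝ), 1 / 2 < ‖charFun μ z‖ := by
    have h1 : Tendsto (fun z => ‖charFun μ z‖) (𝓝[≠] 0) (𝓝 ‖charFun μ 0‖) :=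
      (continuous_charFun.norm.tendsto 0).mono_left nhdsWithin_le_nhds
    refine h1.eventually_const_lt ?_
    simp only [charFun_zero, probReal_univ, Complex.ofReal_one, norm_one]
    norm_num
  obtain ⟨z, hz, hz0⟩ := (h0.and self_mem_nhdsWithin).exists
  have hd : 0 < |z| ^ α * c := mul_pos (Real.rpow_pos_of_pos (abs_pos.2 hz0) _) hc
  have hev := (h z).norm.eventually_const_lt hz
  refine integrableOn_Ioi_of_intervalIntegral_norm_bounded (l := atBot) (b := fun s : ℝ => t - s)
    (Real.log 2 / (|z| ^ α * c)) 0 (fun s => (hg.integrableOn_Icc).mono_set Ioc_subset_Icc_self)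
    (tendsto_const_nhds.add_atTop tendsto_neg_atBot_atTop) ?_
  filter_upwards [hev] with s hs
  simp_rw [Real.norm_eq_abs, abs_of_nonneg (hg0 _)]
  rw [Complex.norm_real, Real.norm_eq_abs, Real.abs_exp] at hs
  have h2 := (Real.log_lt_log (by norm_num) hs)
  rw [Real.log_exp, one_div, Real.log_inv] at h2
  rw [le_div_iff₀ hd]
  linarith

lemma tendsto_exp_integral {α c t : ℝ} {g : ℝ → ℝ} (hg : IntegrableOn g (Ioi 0)) (z : ℝ) :
    Tendsto (fun s : ℝ => ((Real.exp (-(|z| ^ α * c * ∫ r in 0..(t - s), g r)) : ℝ) : ℂ)) atBot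
      (𝓝 ((Real.exp (-(|z| ^ α * c * ∫ r in Ioi 0, g r)) : ℝ) : ℂ)) := by
  have h1 := intervalIntegral_tendsto_integral_Ioi (l := atBot) (b := fun s : ℝ => t - s) 0 hg
    (tendsto_const_nhds.add_atTop tendsto_neg_atBot_atTop)
  exact ((Complex.continuous_ofReal.comp Real.continuous_exp).tendsto _).comp
    ((h1.const_mul _).neg)

end Limit

/-! ### Existence and almost sure identification of solutions. -/

section Solution

variable {Ω : Type*} [MeasurableSpace Ω] {P : Measure Ω} {s ν : ℝ} {ℓ : ℝ → Ω → ℝ}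

lemma IsLevyProcess.ae_isTransportPath (hν : 0 ≤ ν)
    (h : IsLevyProcess (fun u : ℝ≥0 => ℓ (s + (u : ℝ))) P) :
    ∀ᵐ ω ∂P, IsTransportPath ν s (fun t => ℓ t ω) (fun _ => 0)
      (transportPath ν s fun t => ℓ t ω) := by
  filter_upwards [h.isCadlagFrom] with ω hω
  exact isTransportPath_transportPath hν hω.aestronglyMeasurable hω.exists_bound

lemma IsTransportPath.congr {ℓ : ℝ → ℝ} {x₀ : ℕ → ℝ} {x y : ℕ → ℝ → ℝ}
    (h : IsTransportPath ν s ℓ x₀ x) (hxy : ∀ n t, s ≤ t → x n t = y n t) :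
    IsTransportPath ν s ℓ x₀ y := by
  have hle : ∀ {t u : ℝ}, s ≤ t → u ∈ uIcc s t → s ≤ u := fun ht hu => by
    rw [uIcc_of_le ht] at hu
    exact hu.1
  refine ⟨fun T hT => ?_, fun n t ht => ?_, fun t ht => ?_, fun t ht => ?_, fun n hn t ht => ?_⟩
  · obtain ⟨C, hC⟩ := h.bounded T hT
    exact ⟨C, fun n t ht => hxy n t ht.1 ▸ hC n t ht⟩
  · exact (h.integrable n t ht).congr_uIoo fun u hu => hxy n u (hle ht (Ioo_subset_Icc_self hu))
  · rw [← hxy 0 t ht, h.boundary t ht]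
  · rw [← hxy 1 t ht, h.forced t ht]
    congr 2
    refine intervalIntegral.integral_congr fun u hu => ?_
    simp only [hxy _ u (hle ht hu)]
  · rw [← hxy n t ht, h.transport n hn t ht]
    congr 1
    refine intervalIntegral.integral_congr fun u hu => ?_
    simp only [hxy _ u (hle ht hu)]

lemma IsLevyProcess.exists_isTransportSolution (hν : 0 ≤ ν)
    (h : IsLevyProcess (fun u : ℝ≥0 => ℓ (s + (u : ℝ))) P) :
    ∃ a, IsTransportSolution P ν s ℓ (fun _ => 0) a := by
  classical
  -- The value `0` before time `s` secures measurability there, where nothing is known about `ℓ`.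
  refine ⟨fun n t ω => if s ≤ t then transportPath ν s (fun t => ℓ t ω) n t else 0,
    fun n t => ?_, ?_⟩
  · split_ifs with ht
    · exact h.aemeasurable_transportPath ν n ht
    · exact aemeasurable_const
  · filter_upwards [h.ae_isTransportPath hν] with ω hω
    exact hω.congr fun n t ht => (if_pos ht).symm

lemma IsTransportSolution.ae_eq_transportPath (hν : 0 ≤ ν)
    (h : IsLevyProcess (fun u : ℝ≥0 => ℓ (s + (u : ℝ))) P) {a : ℕ → ℝ → Ω → ℝ}
    (ha : IsTransportSolution P ν s ℓ (fun _ => 0) a) (n : ℕ) {t : ℝ} (ht : s ≤ t) :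
    a n t =ᵐ[P] fun ω => transportPath ν s (fun t => ℓ t ω) n t := by
  filter_upwards [ha.path, h.ae_isTransportPath hν] with ω h1 h2
  exact h1.eq hν h2 n ht

end Solution

/-! ### The stationary distribution. -/

theorem mainTheorem3 {Ω : Type*} [MeasurableSpace Ω] (P : Measure Ω) [IsProbabilityMeasure P]
    (α σ ν : ℝ) (hα : 0 < α) (hα2 : α < 2) (hσ : 0 < σ) (hν : 0 ≤ ν)
    (L : ℝ → ℝ → Ω → ℝ)
    (hL : ∀ s : ℝ, IsLevyProcess (fun u : ℝ≥0 => L s (s + (u : ℝ))) P)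
    (hΨ : ∀ s : ℝ, HasCumulant (fun u : ℝ≥0 => L s (s + (u : ℝ)))
      (fun z : ℝ => ((-(σ ^ α * |z| ^ α) : ℝ) : ℂ)) P) :
    (∃ a : ℝ → ℕ → ℝ → Ω → ℝ, ∀ s : ℝ, IsTransportSolution P ν s (L s) (fun _ => 0) (a s)) ∧
    ∀ a : ℝ → ℕ → ℝ → Ω → ℝ,
      (∀ s : ℝ, IsTransportSolution P ν s (L s) (fun _ => 0) (a s)) →
      ∀ n : ℕ, 1 ≤ n → ∀ t : ℝ,
        ((∃ μ : ProbabilityMeasure ℝ, IsPullbackLaw P (fun s => a s n t) μ) ↔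
          (0 < ν ∨ 2 / 3 < α)) ∧
        ∀ μ : ProbabilityMeasure ℝ, IsPullbackLaw P (fun s => a s n t) μ →
          IsStableLaw α (μ : Measure ℝ) ∧
          IntegrableOn (fun r : ℝ =>
            |besselJ n (2 * r)| ^ α / r ^ α * Real.exp (-(α * ν * r))) (Ioi 0) ∧
          ∀ z : ℝ, charFun (μ : Measure ℝ) z =
            ((Real.exp (-(|z| ^ α * σ ^ α * (n : ℝ) ^ α *
              ∫ r in Ioi (0 : ℝ),
                |besselJ n (2 * r)| ^ α / r ^ α * Real.exp (-(α * ν * r)))) : ℝ) : ℂ) := by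
  refine ⟨?_, fun a ha n hn t => ?_⟩
  · choose a ha using fun s => (hL s).exists_isTransportSolution hν
    exact ⟨a, ha⟩
  have hσα : 0 < σ ^ α := Real.rpow_pos_of_pos hσ α
  have hnα : 0 < (n : ℝ) ^ α := Real.rpow_pos_of_pos (by exact_mod_cast hn) α
  have hcont : Continuous fun r => |transportKernel ν n r| ^ α :=
    (continuous_transportKernel ν n).abs.rpow_const fun _ => Or.inr hα.le
  have hchar : ∀ z : ℝ, (fun s => charFun (P.map (a s n t)) z) =ᶠ[atBot] fun s =>
      ((Real.exp (-(|z| ^ α * σ ^ α * ∫ r in 0..(t - s), |transportKernel ν n r| ^ α)) : ℝ) : ℂ) := by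
    intro z
    filter_upwards [eventually_lt_atBot t] with s hs
    rw [Measure.map_congr ((ha s).ae_eq_transportPath hν (hL s) n hs.le),
      (hL s).charFun_transportPath hα (hΨ s) ν n hs z]
  have hintegrable : ∀ μ : ProbabilityMeasure ℝ, IsPullbackLaw P (fun s => a s n t) μ →
      IntegrableOn (fun r => |transportKernel ν n r| ^ α) (Ioi 0) := fun μ hμ =>
    integrableOn_of_tendsto_charFun (μ := (μ : Measure ℝ)) hσα hcont
      (fun r => Real.rpow_nonneg (abs_nonneg _) _)
      fun z => (hμ.tendsto_charFun z).congr' (hchar z)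
  refine ⟨⟨fun ⟨μ, hμ⟩ => ?_, fun h => ?_⟩, fun μ hμ => ?_⟩
  · by_contra! hcon
    obtain rfl : ν = 0 := le_antisymm hcon.1 hν
    exact not_integrableOn_transportKernel_rpow hα hcon.2 hn (hintegrable μ hμ)
  · have hint := integrableOn_transportKernel_rpow hν hα h hn
    obtain ⟨I, hI⟩ : ∃ I : ℝ≥0, (I : ℝ) = ∫ r in Ioi 0, |transportKernel ν n r| ^ α :=
      CanLift.prf _ (integral_nonneg fun r => Real.rpow_nonneg (abs_nonneg _) _)
    -- The limit law is already at hand: the driving process at elapsed time `I = ∫ |k_n|^α` has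
    -- characteristic function `exp(-I σ^α |z|^α)`.
    refine ⟨⟨P.map (L 0 (0 + (I : ℝ))),
      Measure.isProbabilityMeasure_map ((hL 0).measurable I).aemeasurable⟩,
      isPullbackLaw_of_tendsto_charFun (fun s => (ha s).aemeasurable n t) fun z => ?_⟩
    have e : charFun (P.map (L 0 (0 + (I : ℝ)))) z =
        ((Real.exp (-(|z| ^ α * σ ^ α * I)) : ℝ) : ℂ) := by
      refine (hΨ 0 I z).trans ?_
      rw [Complex.ofReal_exp, ← Complex.ofReal_mul]
      congr 2
      ring
    rw [ProbabilityMeasure.coe_mk, e, hI]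
    exact (tendsto_exp_integral hint z).congr' (hchar z).symm
  · have hint := hintegrable μ hμ
    have hformula : ∀ z : ℝ, charFun (μ : Measure ℝ) z =
        ((Real.exp (-(|z| ^ α * (σ ^ α * ∫ r in Ioi 0, |transportKernel ν n r| ^ α))) : ℝ) : ℂ) := by
      intro z
      rw [← mul_assoc]
      exact tendsto_nhds_unique ((hμ.tendsto_charFun z).congr' (hchar z))
        (tendsto_exp_integral hint z)
    have hkernel : EqOn (fun r => |transportKernel ν n r| ^ α) (fun r => (n : ℝ) ^ α *
        (|besselJ n (2 * r)| ^ α / r ^ α * Real.exp (-(α * ν * r)))) (Ioi 0) :=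
      fun r hr => abs_transportKernel_rpow α n hn hr
    refine ⟨isStableLaw_of_charFun hα
      (mul_pos hσα (integral_transportKernel_rpow_pos hn hint)) hformula, ?_, fun z => ?_⟩
    · refine (((integrableOn_congr_fun hkernel measurableSet_Ioi).1 hint).const_mul
        ((n : ℝ) ^ α)⁻¹).congr (ae_of_all _ fun r => ?_)
      exact inv_mul_cancel_left₀ hnα.ne' _
    · rw [hformula z, setIntegral_congr_fun measurableSet_Ioi hkernel, integral_const_mul]
      congr 3
      ring
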